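/- Let $(\mathfrak d,\mathfrak g,\mathfrak h)$ be a Manin quasi-triple: $\mathfrak d$ is a finite-dimensional real Lie algebra with an invariant nondegenerate symmetric bilinear form $(\cdot|\cdot)$, $\mathfrak g\subset\mathfrak d$ is an isotropic Lie subalgebra and $\mathfrak h$ is an isotropic complement of $\mathfrak g$, so that $\mathfrak h\cong\mathfrak g^*$. Let $D$ and $G$ be connected and simply connected Lie groups with Lie algebras $\mathfrak d$ and $\mathfrak g$ (realized by right-invariant vector fields), $G\to D$ the homomorphism integrating $\mathfrak g\subset\mathfrak d$, and assume that $S=D/G$ is a manifold with $D\to S$ a submersion. Let $D$ act on $S$ by left multiplication, with infinitesimal (dressing) action $v\mapsto v_S$, $v_S(s)=\frac{d}{dt}\big|_{0}\exp(tv)s$. For a basis $(e_i)$ of $\mathfrak g$ with dual basis $(\epsilon^i)$ of $\mathfrak h$, write $[\epsilon^i,\epsilon^j]=\sum_k F^{ij}_k\epsilon^k+\Omega^{ijk}e_k$, $F(e_i)=\frac12\sum_{j,k} F_i^{jk}e_j\wedge e_k$, $\Omega=\frac16\sum\Omega^{ijk}e_i\wedge e_j\wedge e_k\in\wedge^3\mathfrak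 g$, $\lambda(\theta)=\sum_i\langle\theta,(\epsilon^i)_S\rangle e_i$ for $\theta\in T^*_sS$, and $\Pi_S(\theta,\theta')=-\langle\theta',\lambda(\theta)_S\rangle$. Let $\Pi_G$ be the multiplicative bivector field on $G$ integrating the cobracket, i.e. $[\Pi_G,\overrightarrow{\xi}]=-\overrightarrow{F(\xi)}$ for $\xi\in\mathfrak g$; explicitly, $\Pi_G$ is the restriction to $G$ of $\overrightarrow r-\overleftarrow r$ with $r=\frac12\sum_i e_i\wedge\epsilon^i\in\wedge^2\mathfrak d$. Let $\Gamma=(G\times S\rightrightarrows S,\Pi,\Omega)$ be the associated quasi-Poisson groupoid: the transformation groupoid with $\alpha(g,s)=gs$, $\beta(g,s)=s$, $(g,hs)(h,s)=(gh,s)$, the bivector field $$\Pi\big((\theta_g,\theta_s),(\theta'_g,\theta'_s)\big)=\Pi_G(\theta_g,\theta'_g)-\Pi_S(\theta_s,\theta'_s)+\langle\theta'_s,(L_g^*\theta_g)_S\rangle-\langle\theta_s,(L_g^*\theta'_g)_S\rangle ,$$ where $L_g^*\theta_g\in\mathfrak g^*\cong\mathfrak h$, and $\Omega$ regarded as a constant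 section of $\wedge^3$ of the Lie algebroid $\mathfrak g\times S$. Let $X$ be a smooth manifold. A quasi-Hamiltonian space with momentum map $J:X\to S$ is a bivector field $\Pi_X$ on $X$ with a smooth action $\Phi:G\times X\to X$ such that $\Phi_*(\Pi_G\oplus\Pi_X)=\Pi_X$ and $\frac12[\Pi_X,\Pi_X]=\Omega_X$ (the image of $\Omega$ under the infinitesimal action $\xi\mapsto\xi_X$, $\xi_X(x)=\frac{d}{dt}\big|_0\Phi(\exp(t\xi),x)$), and $J$ is smooth, $G$-equivariant and satisfies $\Pi_X^\sharp(J^*\theta)=-(\lambda(\theta))_X$ for all $\theta\in T^*S$. A Hamiltonian $\Gamma$-space with momentum map $J:X\to S$ is a bivector field $\Pi_X$ on $X$ with a smooth action of the groupoid $\Gamma$ on $X$ along $J$ such that the graph $\{(\gamma,x,\gamma\cdot x): J(x)=\beta(\gamma)\}$ is coisotropic in $(\Gamma\times X\times X,\Pi\oplus\Pi_X\oplus-\Pi_X)$ and $\frac12[\Pi_X,\Pi_X]=\hat\Omega$, the image of $\Omega$ under the infinitesimal action of the Lie algebroid of $\Gamma$. (i) If $(X,\Pi_X,\Phi)$ is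 a quasi-Hamiltonian space with momentum map $J:X\to S$, then $(X,\Pi_X)$ is a Hamiltonian $\Gamma$-space with momentum map $J$ for the action $(g,s)\cdot x=\Phi(g,x)$, where $g\in G$, $s\in S$, $x\in X$ and $J(x)=s$. (ii) Conversely, if $(X,\Pi_X)$ is a Hamiltonian $\Gamma$-space with momentum map $J:X\to S$, then $(X,\Pi_X)$ is a quasi-Hamiltonian space with momentum map $J$ for the $G$-action $\Phi(g,x)=(g,J(x))\cdot x$. The constructions (i) and (ii) are inverse to each other. -/

import Mathlib

open scoped Manifold ContDiff Topology

noncomputable section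

namespace QuasiPoisson

/-! ### Multivector fields on manifolds -/

section Tensors

variable {E : Type*} [NormedAddCommGroup E] [NormedSpace ℝ E]
  {H : Type*} [TopologicalSpace H] (I : ModelWithCorners ℝ E H)
  {M : Type*} [TopologicalSpace M] [ChartedSpace H M]
  {E' : Type*} [NormedAddCommGroup E'] [NormedSpace ℝ E']
  {H' : Type*} [TopologicalSpace H'] (I' : ModelWithCorners ℝ E' H')
  {M' : Type*} [TopologicalSpace M'] [ChartedSpace H' M']

/-- The cotangent space of `M` at `x`. -/
abbrev Covector (x : M) : Type _ := TangentSpace I x →L[ℝ] ℝ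

/-- The transpose of a continuous linear map between tangent spaces (or any such spaces). -/
def transpose {V W : Type*} [AddCommGroup V] [Module ℝ V] [TopologicalSpace V]
    [AddCommGroup W] [Module ℝ W] [TopologicalSpace W] (A : V →L[ℝ] W) :
    (W →L[ℝ] ℝ) →ₗ[ℝ] (V →L[ℝ] ℝ) where
  toFun ξ := ξ.comp A
  map_add' _ _ := rfl
  map_smul' _ _ := rfl

/-- The differential of a function, as a covector. -/
def dAt (f : M → ℝ) (x : M) : Covector I x := mfderiv I 𝓘(ℝ, ℝ) f x

variable (M) in
/-- Fields of contravariant 2-tensors: a bilinear form on each cotangent space. Bivector fields are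
the smooth alternating ones, see `IsBivectorField`. -/
abbrev TwoTensorField : Type _ := ∀ x : M, Covector I x →ₗ[ℝ] Covector I x →ₗ[ℝ] ℝ

variable (M) in
/-- Fields of trivectors: on a finite-dimensional manifold `⋀³ TₓM` is the space of alternating
3-forms on the cotangent space, with `(u ∧ v ∧ w)(ξ₁, ξ₂, ξ₃)` the determinant of the pairings. -/
abbrev TrivectorField : Type _ := ∀ x : M, Covector I x [⋀^Fin 3]→ₗ[ℝ] ℝ

/-- `{f, g}(x) = P(df, dg)(x)`. -/
def bracketOf (P : TwoTensorField I M) (f g : M → ℝ) (x : M) : ℝ := P x (dAt I f x) (dAt I g x)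

/-- `P` is a (smooth) bivector field. -/
structure IsBivectorField (P : TwoTensorField I M) : Prop where
  alternating : ∀ (x : M) (ξ : Covector I x), P x ξ ξ = 0
  smooth : ∀ f g : M → ℝ, ContMDiff I 𝓘(ℝ, ℝ) ∞ f → ContMDiff I 𝓘(ℝ, ℝ) ∞ g →
    ContMDiff I 𝓘(ℝ, ℝ) ∞ (bracketOf I P f g)

/-- The Schouten bracket `[P, Q](df₁, df₂, df₃)` of two bivector fields, with the sign convention
`[P, Q](df₁, df₂, df₃) = - ∑_{|A| = 2} ε_A (P(d(Q(f_A)), df_{A'}) + Q(d(P(f_A)), df_{A'}))`,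
where `ε_A` is the sign of the permutation `(A', A)` of `(1, 2, 3)`. -/
def schouten (P Q : TwoTensorField I M) (f₁ f₂ f₃ : M → ℝ) (x : M) : ℝ :=
  -((bracketOf I P (bracketOf I Q f₂ f₃) f₁ x - bracketOf I P (bracketOf I Q f₁ f₃) f₂ x
      + bracketOf I P (bracketOf I Q f₁ f₂) f₃ x)
    + (bracketOf I Q (bracketOf I P f₂ f₃) f₁ x - bracketOf I Q (bracketOf I P f₁ f₃) f₂ x
      + bracketOf I Q (bracketOf I P f₁ f₂) f₃ x))

/-- The equation `½ [P, P] = T` of trivector fields. -/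
def HalfSchoutenEq (P : TwoTensorField I M) (T : TrivectorField I M) : Prop :=
  ∀ f₁ f₂ f₃ : M → ℝ, ContMDiff I 𝓘(ℝ, ℝ) ∞ f₁ → ContMDiff I 𝓘(ℝ, ℝ) ∞ f₂ →
    ContMDiff I 𝓘(ℝ, ℝ) ∞ f₃ → ∀ x : M,
      (1 / 2 : ℝ) * schouten I P P f₁ f₂ f₃ x = T x ![dAt I f₁ x, dAt I f₂ x, dAt I f₃ x]

variable {I I'} in
/-- The first component `θ` of a covector `(θ, θ')` on `M × M'`. -/
def covFst (p : M × M') : Covector (I.prod I') p →ₗ[ℝ] Covector I p.1 :=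
  transpose (ContinuousLinearMap.inl ℝ (TangentSpace I p.1) (TangentSpace I' p.2))

variable {I I'} in
/-- The second component `θ'` of a covector `(θ, θ')` on `M × M'`. -/
def covSnd (p : M × M') : Covector (I.prod I') p →ₗ[ℝ] Covector I' p.2 :=
  transpose (ContinuousLinearMap.inr ℝ (TangentSpace I p.1) (TangentSpace I' p.2))

variable {I I'} in
/-- The tensor field `P ⊕ Q` on `M × M'`. -/
def directSum (P : TwoTensorField I M) (Q : TwoTensorField I' M') :
    TwoTensorField (I.prod I') (M × M') := fun p =>
  (P p.1).compl₁₂ (covFst p) (covFst p) + (Q p.2).compl₁₂ (covSnd p) (covSnd p)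

variable {I I'} in
/-- `F_* P = Q`, that is `P(F^* θ, F^* θ') = Q(θ, θ')`. -/
def PushesForward (F : M → M') (P : TwoTensorField I M) (Q : TwoTensorField I' M') : Prop :=
  ∀ (p : M) (θ θ' : Covector I' (F p)),
    P p (transpose (mfderiv I I' F p) θ) (transpose (mfderiv I I' F p) θ') = Q (F p) θ θ'

/-- `ξ` annihilates the tangent space at `p` of the (sub)manifold `S`, the tangent space being the
set of velocities of smooth curves in `S` through `p`. -/
def IsConormal (S : Set M) (p : M) (ξ : Covector I p) : Prop :=
  ∀ γ : ℝ → M, γ 0 = p → ContMDiffAt 𝓘(ℝ, ℝ) I ∞ γ 0 → (∀ᶠ t in 𝓝 (0 : ℝ), γ t ∈ S) →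
    ξ (mfderiv 𝓘(ℝ, ℝ) I γ 0 (1 : ℝ)) = 0

/-- The (sub)manifold `S` is coisotropic with respect to `P`. -/
def IsCoisotropic (P : TwoTensorField I M) (S : Set M) : Prop :=
  ∀ p ∈ S, ∀ ξ η : Covector I p, IsConormal I S p ξ → IsConormal I S p η → P p ξ η = 0

end Tensors

/-! ### Lie groupoids and their Hamiltonian spaces -/

section Groupoids

variable {E : Type*} [NormedAddCommGroup E] [NormedSpace ℝ E]
  {H : Type*} [TopologicalSpace H] (I : ModelWithCorners ℝ E H)
  (Γ : Type*) [TopologicalSpace Γ] [ChartedSpace H Γ]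
  {E' : Type*} [NormedAddCommGroup E'] [NormedSpace ℝ E']
  {H' : Type*} [TopologicalSpace H'] (I' : ModelWithCorners ℝ E' H')
  (M : Type*) [TopologicalSpace M] [ChartedSpace H' M]

/-- A Lie groupoid `Γ ⇉ M`. The product `mul g h` is meaningful only for composable pairs, that is
when `β g = α h`; its values at other pairs are irrelevant. -/
structure LieGroupoid where
  α : Γ → M
  β : Γ → M
  unit : M → Γ
  inv : Γ → Γ
  mul : Γ → Γ → Γ
  smooth_α : ContMDiff I I' ∞ α
  smooth_β : ContMDiff I I' ∞ β
  smooth_unit : ContMDiff I' I ∞ unit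
  smooth_inv : ContMDiff I I ∞ inv
  smooth_mul : ContMDiffOn (I.prod I) I ∞ (fun p : Γ × Γ => mul p.1 p.2) {p | β p.1 = α p.2}
  submersion_α : ∀ g, Function.Surjective (mfderiv I I' α g)
  submersion_β : ∀ g, Function.Surjective (mfderiv I I' β g)
  α_mul : ∀ g h, β g = α h → α (mul g h) = α g
  β_mul : ∀ g h, β g = α h → β (mul g h) = β h
  mul_assoc : ∀ g h k, β g = α h → β h = α k → mul (mul g h) k = mul g (mul h k)
  α_unit : ∀ m, α (unit m) = m
  β_unit : ∀ m, β (unit m) = m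
  unit_mul : ∀ g, mul (unit (α g)) g = g
  mul_unit : ∀ g, mul g (unit (β g)) = g
  α_inv : ∀ g, α (inv g) = β g
  β_inv : ∀ g, β (inv g) = α g
  mul_inv : ∀ g, mul g (inv g) = unit (α g)
  inv_mul : ∀ g, mul (inv g) g = unit (β g)

variable {I Γ I' M}

namespace LieGroupoid

variable (𝒢 : LieGroupoid I Γ I' M)

/-- The fibre at `m` of the Lie algebroid of `Γ`: the vectors at the unit of `m` tangent to the
`β`-fibre. Its sections are identified with the right-invariant vector fields on `Γ`. -/
def algebroid (m : M) : Submodule ℝ (TangentSpace I (𝒢.unit m)) :=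
  LinearMap.ker (mfderiv I I' 𝒢.β (𝒢.unit m)).toLinearMap

/-- Sections `Ω` of `⋀³ A`, where `A` is the Lie algebroid, as alternating 3-forms on the fibres
of `A^*`. -/
abbrev TrivectorSection : Type _ := ∀ m : M, Module.Dual ℝ (𝒢.algebroid m) [⋀^Fin 3]→ₗ[ℝ] ℝ

variable {EX : Type*} [NormedAddCommGroup EX] [NormedSpace ℝ EX]
  {HX : Type*} [TopologicalSpace HX] (IX : ModelWithCorners ℝ EX HX)
  {X : Type*} [TopologicalSpace X] [ChartedSpace HX X]

/-- `X` is a `Γ`-space with momentum map `J` and action `g · x = act g x`. The action is meaningful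
only on `Γ ×_M X = {(g, x) | β g = J x}`; its values at other pairs are irrelevant. -/
structure IsGroupoidSpace (J : X → M) (act : Γ → X → X) : Prop where
  smooth_J : ContMDiff IX I' ∞ J
  smooth_act : ContMDiffOn (I.prod IX) IX ∞ (fun p : Γ × X => act p.1 p.2) {p | 𝒢.β p.1 = J p.2}
  J_act : ∀ g x, 𝒢.β g = J x → J (act g x) = 𝒢.α g
  mul_act : ∀ g h x, 𝒢.β g = 𝒢.α h → J x = 𝒢.β h → act (𝒢.mul g h) x = act g (act h x)
  unit_act : ∀ x, act (𝒢.unit (J x)) x = x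

/-- The infinitesimal action `A_{J x} → T_x X` of the Lie algebroid: the derivative at the unit of
`g ↦ g · x`, a map defined on the `β`-fibre of `J x`, whose tangent space is `A_{J x}`. (The
derivative within the fibre is only determined on vectors tangent to it.) -/
def infAction (J : X → M) (act : Γ → X → X) (x : X) :
    𝒢.algebroid (J x) →ₗ[ℝ] TangentSpace IX x :=
  (mfderivWithin I IX (fun g => act g x) {g | 𝒢.β g = J x} (𝒢.unit (J x))).toLinearMap.comp
    (𝒢.algebroid (J x)).subtype

/-- The map `Γ(⋀³ A) → 𝔛³(X)`, `Ω ↦ Ω̂`, induced by the infinitesimal action. -/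
def hat (J : X → M) (act : Γ → X → X) (Ω : 𝒢.TrivectorSection) : TrivectorField IX X := fun x =>
  (Ω (J x)).compLinearMap
    { toFun := fun θ => θ.toLinearMap.comp (𝒢.infAction IX J act x)
      map_add' := fun _ _ => rfl
      map_smul' := fun _ _ => rfl }

/-- The graph `{(g, x, g · x) | J x = β g}` of the action. -/
def graph (J : X → M) (act : Γ → X → X) : Set (Γ × X × X) :=
  {p | J p.2.1 = 𝒢.β p.1 ∧ p.2.2 = act p.1 p.2.1}

/-- `(X, PX)` is a Hamiltonian `Γ`-space with momentum map `J`, where `Γ` carries the quasi-Poisson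
structure `(P, Ω)`. The graph is always a submanifold, since `β` is a submersion. -/
structure IsHamiltonianSpace (P : TwoTensorField I Γ) (Ω : 𝒢.TrivectorSection)
    (J : X → M) (act : Γ → X → X) (PX : TwoTensorField IX X) : Prop where
  space : 𝒢.IsGroupoidSpace IX J act
  bivector : IsBivectorField IX PX
  coisotropic : IsCoisotropic (I.prod (IX.prod IX)) (directSum P (directSum PX (-PX)))
    (𝒢.graph J act)
  half_schouten : HalfSchoutenEq IX PX (𝒢.hat IX J act Ω)

end LieGroupoid

end Groupoids

/-! ### Manin quasi-triples and their group pairs -/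

/-- A Manin quasi-triple `(𝔡, 𝔤, 𝔥)`: a Lie algebra with an invariant nondegenerate symmetric
bilinear form, an isotropic Lie subalgebra `𝔤` and an isotropic complement `𝔥` of it. (Then
`dim 𝔡 = 2 dim 𝔤` and `𝔤` is maximal isotropic.) -/
structure ManinQuasiTriple (𝔡 : Type*) [LieRing 𝔡] [LieAlgebra ℝ 𝔡] where
  form : LinearMap.BilinForm ℝ 𝔡
  symm : ∀ u v, form u v = form v u
  nondegenerate : form.Nondegenerate
  invariant : ∀ u v w, form ⁅u, v⁆ w = form u ⁅v, w⁆
  g : LieSubalgebra ℝ 𝔡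
  h : Submodule ℝ 𝔡
  isotropic_g : ∀ u ∈ g, ∀ v ∈ g, form u v = 0
  isotropic_h : ∀ u ∈ h, ∀ v ∈ h, form u v = 0
  isCompl : IsCompl g.toSubmodule h

namespace ManinQuasiTriple

variable {𝔡 : Type*} [LieRing 𝔡] [LieAlgebra ℝ 𝔡] (T : ManinQuasiTriple 𝔡)

/-- The pairing `(ξ, η) ↦ (ξ | η)` of `𝔤` and `𝔥`. -/
def pairing : T.g →ₗ[ℝ] T.h →ₗ[ℝ] ℝ :=
  T.form.compl₁₂ T.g.toSubmodule.subtype T.h.subtype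

theorem eq_zero_of_orthogonal (u : 𝔡) (hg : ∀ v ∈ T.g, T.form u v = 0)
    (hh : ∀ v ∈ T.h, T.form u v = 0) : u = 0 := by
  refine T.nondegenerate.1 u fun v => ?_
  obtain ⟨a, ha, b, hb, rfl⟩ := Submodule.mem_sup.1
    (T.isCompl.sup_eq_top ▸ Submodule.mem_top : v ∈ T.g.toSubmodule ⊔ T.h)
  rw [map_add, hg a ha, hh b hb, add_zero]

instance [FiniteDimensional ℝ 𝔡] : T.pairing.IsPerfPair := by
  have : FiniteDimensional ℝ T.g := inferInstanceAs (FiniteDimensional ℝ T.g.toSubmodule)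
  apply LinearMap.IsPerfPair.of_injective
  · refine (injective_iff_map_eq_zero _).2 fun ξ hξ => Subtype.ext ?_
    exact T.eq_zero_of_orthogonal ξ (T.isotropic_g ξ ξ.2)
      fun v hv => LinearMap.congr_fun hξ ⟨v, hv⟩
  · refine (injective_iff_map_eq_zero _).2 fun η hη => Subtype.ext ?_
    refine T.eq_zero_of_orthogonal η (fun v hv => ?_) (T.isotropic_h η η.2)
    rw [T.symm]
    exact LinearMap.congr_fun hη ⟨v, hv⟩

variable [FiniteDimensional ℝ 𝔡]

/-- The identification `𝔤^* ≅ 𝔥`: the image `η` of `a` satisfies `(ξ | η) = a ξ` for `ξ ∈ 𝔤`. -/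
def dualEquiv : Module.Dual ℝ T.g ≃ₗ[ℝ] T.h := T.pairing.flip.toPerfPair.symm

/-- The identification `𝔥^* ≅ 𝔤`: the image `ξ` of `b` satisfies `(ξ | η) = b η` for `η ∈ 𝔥`. In
terms of a basis `e_i` of `𝔤` and the dual basis `ε^i` of `𝔥`, `ξ = ∑ b(ε^i) e_i`. -/
def dualEquiv' : Module.Dual ℝ T.h ≃ₗ[ℝ] T.g := T.pairing.toPerfPair.symm

/-- The projection of `𝔡 = 𝔤 ⊕ 𝔥` onto `𝔤`. -/
def projG : 𝔡 →ₗ[ℝ] T.g := Submodule.projectionOnto T.g.toSubmodule T.h T.isCompl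

/-- For a covector `b` on `𝔡`, the element `∑ b(ε^i) e_i` of `𝔤 ⊆ 𝔡`. -/
def sharp : Module.Dual ℝ 𝔡 →ₗ[ℝ] 𝔡 where
  toFun b := (T.dualEquiv' (b.comp T.h.subtype) : T.g)
  map_add' a b := by simp [LinearMap.add_comp]
  map_smul' c b := by simp [LinearMap.smul_comp]

/-- The `r`-matrix `r = ½ ∑ e_i ∧ ε^i ∈ ⋀² 𝔡`, as a bilinear form on `𝔡^*`:
`r(a, b) = ½ ∑ (a(e_i) b(ε^i) - b(e_i) a(ε^i))`. -/
def rMatrix : Module.Dual ℝ 𝔡 →ₗ[ℝ] Module.Dual ℝ 𝔡 →ₗ[ℝ] ℝ :=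
  LinearMap.mk₂ ℝ (fun a b => (1 / 2 : ℝ) * (a (T.sharp b) - b (T.sharp a)))
    (by intros; simp; ring) (by intros; simp; ring) (by intros; simp; ring) (by intros; simp; ring)

/-- `(η₁, η₂, η₃) ↦ ([η₁, η₂] | η₃)` on `𝔥`. -/
def omegaH : T.h [⋀^Fin 3]→ₗ[ℝ] ℝ where
  toFun η := T.form ⁅(η 0 : 𝔡), (η 1 : 𝔡)⁆ (η 2)
  map_update_add' := by
    intro inst η i a b
    obtain rfl := Subsingleton.elim inst (instDecidableEqFin 3)
    fin_cases i <;> simp [Function.update]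
  map_update_smul' := by
    intro inst η i c a
    obtain rfl := Subsingleton.elim inst (instDecidableEqFin 3)
    fin_cases i <;> simp [Function.update]
  map_eq_zero_of_eq' := by
    intro η i j hij hne
    have h01 : η 0 = η 1 → T.form ⁅(η 0 : 𝔡), (η 1 : 𝔡)⁆ (η 2) = 0 := by
      intro h; rw [h]; simp
    have h12 : η 1 = η 2 → T.form ⁅(η 0 : 𝔡), (η 1 : 𝔡)⁆ (η 2) = 0 := by
      intro h; rw [h, T.invariant]; simp
    have h02 : η 0 = η 2 → T.form ⁅(η 0 : 𝔡), (η 1 : 𝔡)⁆ (η 2) = 0 := by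
      intro h; rw [h, ← lie_skew, map_neg, LinearMap.neg_apply, T.invariant]; simp
    fin_cases i <;> fin_cases j <;>
      first
        | exact absurd rfl hne
        | exact h01 hij
        | exact h01 hij.symm
        | exact h12 hij
        | exact h12 hij.symm
        | exact h02 hij
        | exact h02 hij.symm

/-- The element `Ω ∈ ⋀³ 𝔤` of the quasi-Lie bialgebra, as a 3-form on `𝔤^* ≅ 𝔥`. In terms of dual
bases, `Ω(ε^i, ε^j, ε^k) = ([ε^i, ε^j] | ε^k) = Ω^{ijk}` where
`[ε^i, ε^j] = ∑ F_k^{ij} ε^k + ∑ Ω^{ijk} e_k`. -/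
def omega : Module.Dual ℝ T.g [⋀^Fin 3]→ₗ[ℝ] ℝ :=
  T.omegaH.compLinearMap T.dualEquiv.toLinearMap

end ManinQuasiTriple

section RightInvariant

variable {E : Type*} [NormedAddCommGroup E] [NormedSpace ℝ E]
  {H : Type*} [TopologicalSpace H] (I : ModelWithCorners ℝ E H)
  {G : Type*} [TopologicalSpace G] [ChartedSpace H G] [Group G]

/-- The right-invariant vector field on a Lie group with value `v` at the identity. -/
def rightInvariant (v : GroupLieAlgebra I G) (g : G) : TangentSpace I g :=
  mfderiv I I (fun b : G => b * g) 1 v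

end RightInvariant

/-- A group pair `(D, G)` of a Manin quasi-triple. `D` and `G` are Lie groups with Lie algebras `𝔡`
and `𝔤`, where, as for Lie groupoids, the Lie algebra of a Lie group is identified with its
right-invariant vector fields: the value at the identity of the field of `u ∈ 𝔡` is `lieD u`. The
homomorphism `ι : G → D` integrates the inclusion of `𝔤` in `𝔡`. -/
structure GroupPair {𝔡 : Type*} [LieRing 𝔡] [LieAlgebra ℝ 𝔡] (T : ManinQuasiTriple 𝔡)
    (ED : Type*) [NormedAddCommGroup ED] [NormedSpace ℝ ED]
    (D : Type*) [Group D] [TopologicalSpace D] [ChartedSpace ED D]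
    (EG : Type*) [NormedAddCommGroup EG] [NormedSpace ℝ EG]
    (G : Type*) [Group G] [TopologicalSpace G] [ChartedSpace EG G] where
  lieD : 𝔡 ≃ₗ[ℝ] GroupLieAlgebra 𝓘(ℝ, ED) D
  lieD_bracket : ∀ u v : 𝔡,
    VectorField.mlieBracket 𝓘(ℝ, ED) (rightInvariant 𝓘(ℝ, ED) (lieD u))
      (rightInvariant 𝓘(ℝ, ED) (lieD v)) = rightInvariant 𝓘(ℝ, ED) (lieD ⁅u, v⁆)
  lieG : T.g ≃ₗ[ℝ] GroupLieAlgebra 𝓘(ℝ, EG) G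
  ι : G →* D
  smooth_ι : ContMDiff 𝓘(ℝ, EG) 𝓘(ℝ, ED) ∞ ι
  deriv_ι : ∀ ξ : T.g, mfderiv 𝓘(ℝ, EG) 𝓘(ℝ, ED) ι 1 (lieG ξ) = lieD (ξ : 𝔡)

namespace GroupPair

variable {𝔡 : Type*} [LieRing 𝔡] [LieAlgebra ℝ 𝔡] {T : ManinQuasiTriple 𝔡}
  {ED : Type*} [NormedAddCommGroup ED] [NormedSpace ℝ ED]
  {D : Type*} [Group D] [TopologicalSpace D] [ChartedSpace ED D]
  {EG : Type*} [NormedAddCommGroup EG] [NormedSpace ℝ EG]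
  {G : Type*} [Group G] [TopologicalSpace G] [ChartedSpace EG G]
  (P : GroupPair T ED D EG G)

/-- The homogeneous space `S = D/G`. -/
abbrev S : Type _ := D ⧸ P.ι.range

/-! #### The smooth structure of `S = D/G` and the transformation groupoid -/

section Groupoid

variable {ES : Type*} [NormedAddCommGroup ES] [NormedSpace ℝ ES] [ChartedSpace ES P.S]

theorem exists_local_section
    (hS : Manifold.IsSubmersion 𝓘(ℝ, ED) 𝓘(ℝ, ES) ∞ (QuotientGroup.mk : D → P.S)) (x₀ : D) :
    ∃ σ : P.S → D, ContMDiffAt 𝓘(ℝ, ES) 𝓘(ℝ, ED) ∞ σ (QuotientGroup.mk x₀) ∧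
      ∀ᶠ s in 𝓝 (QuotientGroup.mk x₀ : P.S), (QuotientGroup.mk (σ s) : P.S) = s := by
  have h := hS.isSubmersionAt x₀
  set φ := h.domChart.extend 𝓘(ℝ, ED) with hφ
  set ψ := h.codChart.extend 𝓘(ℝ, ES) with hψ
  have hx : x₀ ∈ φ.source := by
    rw [hφ, OpenPartialHomeomorph.extend_source]; exact h.mem_domChart_source
  have hfx : (QuotientGroup.mk x₀ : P.S) ∈ h.codChart.source := h.mem_codChart_source
  let τ : P.S → ED := fun s => h.equiv.symm (ψ s, (h.equiv (φ x₀)).2)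
  have hτ : ContMDiffAt 𝓘(ℝ, ES) 𝓘(ℝ, ED) ∞ τ (QuotientGroup.mk x₀) := by
    have h1 : ContMDiffAt 𝓘(ℝ, ES) 𝓘(ℝ, ES) ∞ ψ (QuotientGroup.mk x₀ : P.S) :=
      h.codChart.contMDiffAt_extend h.codChart_mem_maximalAtlas hfx
    have h2 : ContDiff ℝ ∞ (fun y : ES => h.equiv.symm (y, (h.equiv (φ x₀)).2)) := by fun_prop
    exact h2.contMDiff.contMDiffAt.comp _ h1
  have hτ0 : τ (QuotientGroup.mk x₀) = φ x₀ := by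
    have := h.writtenInCharts (φ.map_source hx)
    simp only [Function.comp_apply, ← hφ, ← hψ, φ.left_inv hx] at this
    simp only [τ, this, Prod.mk.eta, ContinuousLinearEquiv.symm_apply_apply]
  have htarget : φ.target ∈ 𝓝 (φ x₀) := by
    rw [hφ]
    exact h.domChart.isOpen_extend_target.mem_nhds (φ.map_source hx)
  refine ⟨fun s => φ.symm (τ s), ?_, ?_⟩
  · have h3 : ContMDiffAt 𝓘(ℝ, ED) 𝓘(ℝ, ED) ∞ φ.symm (τ (QuotientGroup.mk x₀)) := by
      rw [hτ0]
      have := contMDiffOn_extend_symm (I := 𝓘(ℝ, ED)) h.domChart_mem_maximalAtlas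
      refine this.contMDiffAt ?_
      simpa [hφ, OpenPartialHomeomorph.extend_target] using htarget
    exact h3.comp _ hτ
  · have h4 : ∀ᶠ s in 𝓝 (QuotientGroup.mk x₀ : P.S), τ s ∈ φ.target :=
      hτ.continuousAt.eventually (by rw [hτ0]; exact htarget)
    filter_upwards [h4, h.codChart.open_source.mem_nhds hfx] with s hs hs'
    have h5 := h.writtenInCharts hs
    simp only [Function.comp_apply, ← hφ, ← hψ, τ,
      ContinuousLinearEquiv.apply_symm_apply] at h5
    refine ψ.injOn ?_ ?_ h5
    · rw [hψ, OpenPartialHomeomorph.extend_source]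
      refine h.source_subset_preimage_source ?_
      have := φ.map_target hs
      rwa [hφ, OpenPartialHomeomorph.extend_source] at this
    · rwa [hψ, OpenPartialHomeomorph.extend_source]

theorem contMDiff_action [LieGroup 𝓘(ℝ, ED) ∞ D]
    (hS : Manifold.IsSubmersion 𝓘(ℝ, ED) 𝓘(ℝ, ES) ∞ (QuotientGroup.mk : D → P.S)) :
    ContMDiff (𝓘(ℝ, ED).prod 𝓘(ℝ, ES)) 𝓘(ℝ, ES) ∞ (fun p : D × P.S => p.1 • p.2) := by
  rintro ⟨d, s⟩
  obtain ⟨x₀, rfl⟩ := QuotientGroup.mk_surjective s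
  obtain ⟨σ, hσ, hσ'⟩ := P.exists_local_section hS x₀
  have h1 : ContMDiffAt (𝓘(ℝ, ED).prod 𝓘(ℝ, ES)) 𝓘(ℝ, ED) ∞ (fun p : D × P.S => p.1 * σ p.2)
      (d, (QuotientGroup.mk x₀ : P.S)) :=
    contMDiffAt_fst.mul (ContMDiffAt.comp (d, (QuotientGroup.mk x₀ : P.S)) hσ contMDiffAt_snd)
  have h2 := (hS.contMDiff (d * σ (QuotientGroup.mk x₀))).comp
    (d, (QuotientGroup.mk x₀ : P.S)) h1
  refine h2.congr_of_eventuallyEq ?_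
  have h3 : Filter.Tendsto (fun p : D × P.S => p.2) (𝓝 (d, (QuotientGroup.mk x₀ : P.S)))
    (𝓝 (QuotientGroup.mk x₀)) := continuousAt_snd
  filter_upwards [h3.eventually hσ'] with p hp
  conv_lhs => rw [← hp]
  rfl

theorem contMDiff_actionG [LieGroup 𝓘(ℝ, ED) ∞ D]
    (hS : Manifold.IsSubmersion 𝓘(ℝ, ED) 𝓘(ℝ, ES) ∞ (QuotientGroup.mk : D → P.S)) :
    ContMDiff (𝓘(ℝ, EG).prod 𝓘(ℝ, ES)) 𝓘(ℝ, ES) ∞ (fun p : G × P.S => P.ι p.1 • p.2) :=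
  (P.contMDiff_action hS).comp ((P.smooth_ι.comp contMDiff_fst).prodMk contMDiff_snd)

theorem surjective_mfderiv_actionG [LieGroup 𝓘(ℝ, ED) ∞ D] [LieGroup 𝓘(ℝ, EG) ∞ G]
    [IsManifold 𝓘(ℝ, ES) ∞ P.S]
    (hS : Manifold.IsSubmersion 𝓘(ℝ, ED) 𝓘(ℝ, ES) ∞ (QuotientGroup.mk : D → P.S)) (p : G × P.S) :
    Function.Surjective (mfderiv (𝓘(ℝ, EG).prod 𝓘(ℝ, ES)) 𝓘(ℝ, ES)
      (fun p : G × P.S => P.ι p.1 • p.2) p) := by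
  obtain ⟨g, s⟩ := p
  let k : P.S → G × P.S := fun s' => (g, (P.ι g)⁻¹ • s')
  have hk : ContMDiff 𝓘(ℝ, ES) (𝓘(ℝ, EG).prod 𝓘(ℝ, ES)) ∞ k :=
    contMDiff_const.prodMk ((P.contMDiff_action hS).comp (contMDiff_const.prodMk contMDiff_id))
  have key : ∀ s' : P.S, Function.Surjective (mfderiv (𝓘(ℝ, EG).prod 𝓘(ℝ, ES)) 𝓘(ℝ, ES)
      (fun p : G × P.S => P.ι p.1 • p.2) (k s')) := by
    intro s'
    have h1 := HasMFDerivAt.comp s'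
      ((P.contMDiff_actionG hS).mdifferentiableAt (x := k s') (by simp)).hasMFDerivAt
      (hk.mdifferentiableAt (x := s') (by simp)).hasMFDerivAt
    have h2 : (fun p : G × P.S => P.ι p.1 • p.2) ∘ k = id := by
      funext s''; simp [k]
    rw [h2] at h1
    have h3 := hasMFDerivAt_unique h1 (hasMFDerivAt_id s')
    intro v
    exact ⟨mfderiv 𝓘(ℝ, ES) (𝓘(ℝ, EG).prod 𝓘(ℝ, ES)) k s' v, DFunLike.congr_fun h3 v⟩
  have hp : k (P.ι g • s) = (g, s) := by simp [k]
  exact hp ▸ key (P.ι g • s)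

/-- The transformation groupoid `G × S ⇉ S` of the dressing action of `G` on `S`:
`α(g, s) = g s`, `β(g, s) = s` and `(g, h s) (h, s) = (g h, s)`. -/
def groupoid [LieGroup 𝓘(ℝ, ED) ∞ D] [LieGroup 𝓘(ℝ, EG) ∞ G] [IsManifold 𝓘(ℝ, ES) ∞ P.S]
    (hS : Manifold.IsSubmersion 𝓘(ℝ, ED) 𝓘(ℝ, ES) ∞ (QuotientGroup.mk : D → P.S)) :
    LieGroupoid (𝓘(ℝ, EG).prod 𝓘(ℝ, ES)) (G × P.S) 𝓘(ℝ, ES) P.S where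
  α p := P.ι p.1 • p.2
  β p := p.2
  unit s := (1, s)
  inv p := (p.1⁻¹, P.ι p.1 • p.2)
  mul p q := (p.1 * q.1, q.2)
  smooth_α := P.contMDiff_actionG hS
  smooth_β := contMDiff_snd
  smooth_unit := contMDiff_const.prodMk contMDiff_id
  smooth_inv := (contMDiff_fst.inv).prodMk (P.contMDiff_actionG hS)
  smooth_mul := ContMDiff.contMDiffOn <|
    ((contMDiff_fst.comp contMDiff_fst).mul (contMDiff_fst.comp contMDiff_snd)).prodMk
      (contMDiff_snd.comp contMDiff_snd)
  submersion_α := P.surjective_mfderiv_actionG hS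
  submersion_β p := by
    intro v
    refine ⟨((0 : TangentSpace 𝓘(ℝ, EG) p.1), v), ?_⟩
    rw [show mfderiv (𝓘(ℝ, EG).prod 𝓘(ℝ, ES)) 𝓘(ℝ, ES) (fun p : G × P.S => p.2) p = _ from
      mfderiv_snd]
    rfl
  α_mul p q h := by
    change p.2 = P.ι q.1 • q.2 at h
    simp [h, mul_smul]
  β_mul _ _ _ := rfl
  mul_assoc p q r _ _ := by simp [mul_assoc]
  α_unit s := by simp
  β_unit _ := rfl
  unit_mul p := by simp
  mul_unit p := by simp
  α_inv p := by simp
  β_inv _ := rfl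
  mul_inv p := by simp
  inv_mul p := by simp

/-- The identification of `𝔤` with the fibre at `s` of the Lie algebroid of `G × S ⇉ S`. -/
def toAlgebroid [LieGroup 𝓘(ℝ, ED) ∞ D] [LieGroup 𝓘(ℝ, EG) ∞ G] [IsManifold 𝓘(ℝ, ES) ∞ P.S]
    (hS : Manifold.IsSubmersion 𝓘(ℝ, ED) 𝓘(ℝ, ES) ∞ (QuotientGroup.mk : D → P.S)) (s : P.S) :
    T.g →ₗ[ℝ] (P.groupoid hS).algebroid s :=
  LinearMap.codRestrict _
    ((ContinuousLinearMap.inl ℝ (TangentSpace 𝓘(ℝ, EG) (1 : G))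
      (TangentSpace 𝓘(ℝ, ES) s)).toLinearMap.comp P.lieG.toLinearMap)
    (by
      intro ξ
      change mfderiv (𝓘(ℝ, EG).prod 𝓘(ℝ, ES)) 𝓘(ℝ, ES) (fun p : G × P.S => p.2) ((1 : G), s) _ = 0
      rw [show mfderiv (𝓘(ℝ, EG).prod 𝓘(ℝ, ES)) 𝓘(ℝ, ES) (fun p : G × P.S => p.2) ((1 : G), s) = _
        from mfderiv_snd]
      rfl)

/-- The element `Ω ∈ ⋀³ 𝔤` as a constant section of `⋀³ A`, where `A = 𝔤 × S` is the Lie algebroid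
of `G × S ⇉ S`. -/
def omegaSection [FiniteDimensional ℝ 𝔡] [LieGroup 𝓘(ℝ, ED) ∞ D] [LieGroup 𝓘(ℝ, EG) ∞ G]
    [IsManifold 𝓘(ℝ, ES) ∞ P.S]
    (hS : Manifold.IsSubmersion 𝓘(ℝ, ED) 𝓘(ℝ, ES) ∞ (QuotientGroup.mk : D → P.S)) :
    (P.groupoid hS).TrivectorSection := fun s =>
  T.omega.compLinearMap (P.toAlgebroid hS s).dualMap

end Groupoid

/-! #### The quasi-Poisson Lie group `G` -/

/-- The adjoint action of `D` on `𝔡`. -/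
def Ad (d : D) : 𝔡 →ₗ[ℝ] 𝔡 :=
  P.lieD.symm.toLinearMap.comp
    ((mfderiv 𝓘(ℝ, ED) 𝓘(ℝ, ED) (fun b : D => d * b * d⁻¹) 1).toLinearMap.comp
      P.lieD.toLinearMap)

/-- The right translation `R_{g*} : 𝔤 → T_g G`. -/
def rightG (g : G) : T.g →ₗ[ℝ] TangentSpace 𝓘(ℝ, EG) g :=
  (mfderiv 𝓘(ℝ, EG) 𝓘(ℝ, EG) (fun b : G => b * g) 1).toLinearMap.comp P.lieG.toLinearMap

/-- The left translation `L_{g*} : 𝔤 → T_g G`. -/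
def leftG (g : G) : T.g →ₗ[ℝ] TangentSpace 𝓘(ℝ, EG) g :=
  (mfderiv 𝓘(ℝ, EG) 𝓘(ℝ, EG) (fun b : G => g * b) 1).toLinearMap.comp P.lieG.toLinearMap

/-- `L_g^* θ ∈ 𝔤^*`. -/
def coLeftG (g : G) : Covector 𝓘(ℝ, EG) g →ₗ[ℝ] Module.Dual ℝ T.g where
  toFun θ := θ.toLinearMap.comp (P.leftG g)
  map_add' _ _ := rfl
  map_smul' _ _ := rfl

variable [FiniteDimensional ℝ 𝔡]

/-- `R_g^* θ ∈ 𝔤^*`, extended to `𝔡` by zero on `𝔥`. -/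
def coRightG (g : G) : Covector 𝓘(ℝ, EG) g →ₗ[ℝ] Module.Dual ℝ 𝔡 where
  toFun θ := (θ.toLinearMap.comp (P.rightG g)).comp T.projG
  map_add' _ _ := rfl
  map_smul' _ _ := rfl

/-- The bivector field `Π_G` of the quasi-Poisson Lie group `G`, namely the restriction to `G` of
the bivector field `R_{d*} r - L_{d*} r = R_{d*} (r - Ad_d r)` on `D`, which along `G` is tangent
to `G` (so that it can be evaluated on arbitrary extensions of covectors of `G` to `D`). It is the
multiplicative bivector field on `G` with `[Π_G, →ξ] = →[r, ξ] = - →F(ξ)` for `ξ ∈ 𝔤`, where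
`→` denotes right-invariant extension and `F(e_i) = ½ ∑ F_i^{jk} e_j ∧ e_k` is the cobracket,
`[ε^j, ε^k] = ∑ F_i^{jk} ε^i + ∑ Ω^{jki} e_i`. -/
def PiG : TwoTensorField 𝓘(ℝ, EG) G := fun g =>
  LinearMap.mk₂ ℝ
    (fun θ θ' => T.rMatrix (P.coRightG g θ) (P.coRightG g θ')
      - T.rMatrix (P.coRightG g θ ∘ₗ P.Ad (P.ι g)) (P.coRightG g θ' ∘ₗ P.Ad (P.ι g)))
    (by intros; simp [LinearMap.add_comp]; ring) (by intros; simp [LinearMap.smul_comp]; ring)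
    (by intros; simp [LinearMap.add_comp]; ring) (by intros; simp [LinearMap.smul_comp]; ring)

/-! #### The dressing action on `S = D/G` -/

variable {ES : Type*} [NormedAddCommGroup ES] [NormedSpace ℝ ES] [ChartedSpace ES P.S]

/-- The infinitesimal dressing action `v ↦ v_S(s) = d/dt (exp (t v) s)` of `𝔡` on `S`. -/
def dressing (s : P.S) : 𝔡 →ₗ[ℝ] TangentSpace 𝓘(ℝ, ES) s :=
  (mfderiv 𝓘(ℝ, ED) 𝓘(ℝ, ES) (fun d : D => d • s) 1).toLinearMap.comp P.lieD.toLinearMap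

/-- The covector `η ↦ ⟨θ, η_S(s)⟩` on `𝔥`. -/
def coDress (s : P.S) : Covector 𝓘(ℝ, ES) s →ₗ[ℝ] Module.Dual ℝ T.h where
  toFun θ := (θ.toLinearMap.comp (P.dressing s)).comp T.h.subtype
  map_add' _ _ := rfl
  map_smul' _ _ := rfl

/-- The map `λ : T_s^* S → 𝔤` dual to the infinitesimal dressing action of `𝔥 ≅ 𝔤^*`:
`(λ(θ) | η) = ⟨θ, η_S(s)⟩` for `η ∈ 𝔥`. -/
def lam (s : P.S) : Covector 𝓘(ℝ, ES) s →ₗ[ℝ] T.g :=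
  T.dualEquiv'.toLinearMap.comp (P.coDress s)

/-- The bivector field `Π_S` on `S`: `Π_S(θ, θ') = - ∑ ⟨θ, (ε^i)_S⟩ ⟨θ', (e_i)_S⟩`, that is,
`Π_S(θ, θ') = - ⟨θ', λ(θ)_S⟩`. -/
def PiS : TwoTensorField 𝓘(ℝ, ES) P.S := fun s =>
  LinearMap.mk₂ ℝ (fun θ θ' => -θ' (P.dressing s (P.lam s θ)))
    (by intros; simp; ring) (by intros; simp) (by intros; simp; ring) (by intros; simp)

/-- The vector `(L_g^* θ)_S(s)`, where `L_g^* θ ∈ 𝔤^* ≅ 𝔥`. -/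
def coDressing (g : G) (s : P.S) : Covector 𝓘(ℝ, EG) g →ₗ[ℝ] TangentSpace 𝓘(ℝ, ES) s :=
  (P.dressing s).comp (T.h.subtype.comp (T.dualEquiv.toLinearMap.comp (P.coLeftG g)))

/-- The pairing `(θ_g, θ_s) ↦ ⟨θ_s, (L_g^* θ_g)_S(s)⟩`. -/
def cross (g : G) (s : P.S) : Covector 𝓘(ℝ, EG) g →ₗ[ℝ] Covector 𝓘(ℝ, ES) s →ₗ[ℝ] ℝ :=
  LinearMap.mk₂ ℝ (fun θ θ' => θ' (P.coDressing g s θ))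
    (by intros; simp) (by intros; simp) (by intros; simp) (by intros; simp)

/-! #### The quasi-Poisson groupoid `G × S ⇉ S` -/

/-- The bivector field `Π` on `G × S`:
`Π((θ_g, θ_s), (θ'_g, θ'_s)) = Π_G(θ_g, θ'_g) - Π_S(θ_s, θ'_s)
  + ⟨θ'_s, (L_g^* θ_g)_S⟩ - ⟨θ_s, (L_g^* θ'_g)_S⟩`. -/
def PiGroupoid : TwoTensorField (𝓘(ℝ, EG).prod 𝓘(ℝ, ES)) (G × P.S) := fun p =>
  (P.PiG p.1).compl₁₂ (covFst p) (covFst p) - (P.PiS p.2).compl₁₂ (covSnd p) (covSnd p)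
    + (P.cross p.1 p.2).compl₁₂ (covFst p) (covSnd p)
    - ((P.cross p.1 p.2).compl₁₂ (covFst p) (covSnd p)).flip

/-! #### Quasi-Hamiltonian spaces with `D/G`-valued momentum map -/

section QuasiHamiltonian

variable {EX : Type*} [NormedAddCommGroup EX] [NormedSpace ℝ EX]
  {X : Type*} [TopologicalSpace X] [ChartedSpace EX X]

/-- The infinitesimal action `ξ ↦ ξ_X(x) = d/dt Φ(exp (t ξ), x)` of `𝔤` on `X`. -/
def infGenerator (Φ : G → X → X) (x : X) : T.g →ₗ[ℝ] TangentSpace 𝓘(ℝ, EX) x :=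
  (mfderiv 𝓘(ℝ, EG) 𝓘(ℝ, EX) (fun g : G => Φ g x) 1).toLinearMap.comp P.lieG.toLinearMap

/-- The trivector field `Ω_X` induced by `Ω ∈ ⋀³ 𝔤` and the infinitesimal action. -/
def omegaX (Φ : G → X → X) : TrivectorField 𝓘(ℝ, EX) X := fun x =>
  T.omega.compLinearMap
    { toFun := fun θ => θ.toLinearMap.comp (P.infGenerator Φ x)
      map_add' := fun _ _ => rfl
      map_smul' := fun _ _ => rfl }

/-- `Φ` is a quasi-Poisson action of the quasi-Poisson Lie group `(G, Π_G, Ω)` on `(X, PX)`. -/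
structure IsQuasiPoissonAction (Φ : G → X → X) (PX : TwoTensorField 𝓘(ℝ, EX) X) : Prop where
  bivector : IsBivectorField 𝓘(ℝ, EX) PX
  smooth : ContMDiff (𝓘(ℝ, EG).prod 𝓘(ℝ, EX)) 𝓘(ℝ, EX) ∞ (fun p : G × X => Φ p.1 p.2)
  one_act : ∀ x, Φ 1 x = x
  mul_act : ∀ g h x, Φ (g * h) x = Φ g (Φ h x)
  pushesForward : PushesForward (fun p : G × X => Φ p.1 p.2) (directSum P.PiG PX) PX
  half_schouten : HalfSchoutenEq 𝓘(ℝ, EX) PX (P.omegaX Φ)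

/-- `(X, PX)` with the action `Φ` is a quasi-Hamiltonian space with momentum map `J : X → S`:
`Φ` is a quasi-Poisson action, `J` is `G`-equivariant, and `PX^♯(J^* θ) = -(λ(θ))_X`, where
`⟨PX^♯(φ), ψ⟩ = PX(φ, ψ)`. -/
structure IsQuasiHamiltonian (Φ : G → X → X) (PX : TwoTensorField 𝓘(ℝ, EX) X) (J : X → P.S) :
    Prop where
  action : P.IsQuasiPoissonAction Φ PX
  smooth_J : ContMDiff 𝓘(ℝ, EX) 𝓘(ℝ, ES) ∞ J
  equivariant : ∀ g x, J (Φ g x) = P.ι g • J x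
  momentum : ∀ (x : X) (θ : Covector 𝓘(ℝ, ES) (J x)) (ψ : Covector 𝓘(ℝ, EX) x),
    PX x (transpose (mfderiv 𝓘(ℝ, EX) 𝓘(ℝ, ES) J x) θ) ψ
      = -ψ (P.infGenerator Φ x (P.lam (J x) θ))

/-- The extension `(g, s) · x = Φ(g, x)`, `s = J(x)`, of a `G`-action to the groupoid `G × S`. -/
def extendAction (Φ : G → X → X) : G × P.S → X → X := fun γ x => Φ γ.1 x

/-- The map `Φ(g, x) = (g, J(x)) · x` defined by an action of the groupoid `G × S`. -/
def restrictAction (J : X → P.S) (act : G × P.S → X → X) : G → X → X := fun g x => act (g, J x) x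

end QuasiHamiltonian

end GroupPair

end QuasiPoisson

end

open QuasiPoisson

/-! Everything rests on reading coisotropy of the graph as a set of pointwise identities. A pair
`(γ, x)` with `β γ = J x` is the same as a point `(g, x)` of `G × X`, so the graph is the image of
`(g, x) ↦ ((g, J x), (x, Φ(g, x)))`, which has a smooth left inverse. Its conormal covectors are
therefore those killing the image of the derivative, and they are freely parametrised by a covector
`θ` on `S` at `J x` and a covector `ψ` on `X` at `Φ(g, x)` (`isConormal_graph_iff`).

Evaluating `Π ⊕ Π_X ⊕ -Π_X` on two such covectors `(θ, ψ)`, `(θ', ψ')` gives four terms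
(`directSum_conormal_apply`). The `ψψ'` term is the defect of `Φ_*(Π_G ⊕ Π_X) = Π_X`. The two mixed
terms are defects of the momentum condition, paired with the pullbacks of `ψ'` and `ψ` under `Φ_g`;
here the cross terms of `Π` become infinitesimal generators because `λ` is dual to the dressing
action of `𝔥`. The `θθ'` term is `Π_X(J^*θ, J^*θ') + ⟨θ', λ(θ)_S⟩`, which vanishes by the momentum
condition and the infinitesimal equivariance of `J`. Hence coisotropy is equivalent to the
pushforward condition together with the momentum condition (`isCoisotropic_graph_iff`).

The two Schouten equations agree because the algebroid `𝔤 × S` acts on `X` through the generators of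
`𝔤` (`hat_omegaSection`). The remaining action axioms translate directly. -/

namespace QuasiPoisson

/-! ### Conormal covectors of the image of an embedding -/

section Conormal

variable {E : Type*} [NormedAddCommGroup E] [NormedSpace ℝ E]
  {H : Type*} [TopologicalSpace H] {I : ModelWithCorners ℝ E H}
  {N : Type*} [TopologicalSpace N] [ChartedSpace H N]
  {E' : Type*} [NormedAddCommGroup E'] [NormedSpace ℝ E']
  {H' : Type*} [TopologicalSpace H'] {I' : ModelWithCorners ℝ E' H'}
  {M : Type*} [TopologicalSpace M] [ChartedSpace H' M]

/-- On a boundaryless manifold every tangent vector is the velocity of a smooth curve. -/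
theorem exists_curve_hasMFDerivAt [I.Boundaryless] [IsManifold I ∞ N] (q : N)
    (v : TangentSpace I q) :
    ∃ c : ℝ → N, c 0 = q ∧ ContMDiffAt 𝓘(ℝ, ℝ) I ∞ c 0 ∧
      mfderiv 𝓘(ℝ, ℝ) I c 0 (1 : ℝ) = v := by
  have : IsManifold I 1 N := IsManifold.of_le (n := ∞) (by simp)
  -- The curve is a straight line in the preferred chart at `q`. A tangent vector at `q` is by
  -- definition an element of the model space, so `v` itself serves as its direction there.
  let v' : E := v
  let l : ℝ → E := fun t => extChartAt I q q + t • v'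
  have hl0 : l 0 = extChartAt I q q := by simp [l]
  have hl : ContMDiff 𝓘(ℝ, ℝ) 𝓘(ℝ, E) ∞ l := by
    refine ContDiff.contMDiff ?_
    fun_prop
  have hdl : HasMFDerivAt 𝓘(ℝ, ℝ) 𝓘(ℝ, E) l 0 (ContinuousLinearMap.toSpanSingleton ℝ v') := by
    refine HasFDerivAt.hasMFDerivAt ?_
    have h := ((hasDerivAt_id (0 : ℝ)).smul_const v').const_add (extChartAt I q q)
    rw [one_smul] at h
    exact h.hasFDerivAt
  have hs : ContMDiffAt 𝓘(ℝ, E) I ∞ (extChartAt I q).symm (l 0) := by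
    have h := contMDiffOn_extChartAt_symm (I := I) (n := ∞) q
    rw [hl0]
    refine h.contMDiffAt ?_
    exact extChartAt_target_mem_nhds q
  have hds : HasMFDerivAt 𝓘(ℝ, E) I (extChartAt I q).symm (l 0)
      (mfderiv 𝓘(ℝ, E) I (extChartAt I q).symm (l 0)) :=
    (hs.mdifferentiableAt (by simp)).hasMFDerivAt
  refine ⟨fun t => (extChartAt I q).symm (l t), by simp [hl0], hs.comp (0 : ℝ) hl.contMDiffAt, ?_⟩
  have h := (hds.comp (0 : ℝ) hdl).mfderiv
  -- At its own base point the inverse chart has identity derivative; absence of boundary replaces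
  -- the derivative within the range of `I` by the full one.
  have hid : ∀ w : E, mfderiv 𝓘(ℝ, E) I (extChartAt I q).symm (extChartAt I q q) w = w := by
    intro w
    have h1 := mfderivWithin_range_extChartAt_symm (𝕜 := ℝ) (I := I) (x := q)
    rw [I.range_eq_univ, mfderivWithin_univ] at h1
    exact DFunLike.congr_fun h1 w
  have h2 := DFunLike.congr_fun h (1 : ℝ)
  refine h2.trans ?_
  change mfderiv 𝓘(ℝ, E) I (extChartAt I q).symm (l 0) ((1 : ℝ) • v') = v
  rw [one_smul, hl0]
  exact hid v

/-- The conormal space of the image of an embedding with a smooth left inverse. -/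
theorem isConormal_range_iff [I.Boundaryless] [IsManifold I ∞ N] {F : N → M} {K : M → N}
    (hF : ContMDiff I I' ∞ F) (hK : ContMDiff I' I ∞ K) (hKF : ∀ q, K (F q) = q) (q : N)
    (ξ : Covector I' (F q)) :
    IsConormal I' (Set.range F) (F q) ξ ↔ ∀ v : TangentSpace I q, ξ (mfderiv I I' F q v) = 0 := by
  constructor
  · intro h v
    obtain ⟨c, hc0, hc, hcv⟩ := exists_curve_hasMFDerivAt (I := I) q v
    subst hc0
    have h1 := h (fun t => F (c t)) rfl (hF.contMDiffAt.comp (0 : ℝ) hc)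
      (Filter.Eventually.of_forall fun t => ⟨c t, rfl⟩)
    have h2 := (HasMFDerivAt.comp (0 : ℝ) ((hF.mdifferentiableAt (x := c 0)
      (by simp)).hasMFDerivAt) (hc.mdifferentiableAt (by simp)).hasMFDerivAt).mfderiv
    rw [← hcv]
    exact (congrArg ξ (DFunLike.congr_fun h2 (1 : ℝ)).symm).trans h1
  · intro h γ hγ0 hγ hmem
    -- The left inverse lifts a curve in the image to a smooth curve in `N`. Near `0` the curve is
    -- `F` of its lift, so its velocity lies in the image of the derivative of `F`.
    have hc : ContMDiffAt 𝓘(ℝ, ℝ) I ∞ (fun t => K (γ t)) 0 := hK.contMDiffAt.comp (0 : ℝ) hγ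
    have hq : K (γ 0) = q := by rw [hγ0, hKF]
    have heq : γ =ᶠ[𝓝 0] fun t => F (K (γ t)) := by
      filter_upwards [hmem] with t ht
      obtain ⟨q', hq'⟩ := ht
      simp only [← hq', hKF]
    subst hq
    have h2 := (HasMFDerivAt.comp (0 : ℝ) ((hF.mdifferentiableAt (x := K (γ 0))
      (by simp)).hasMFDerivAt) (hc.mdifferentiableAt (by simp)).hasMFDerivAt).mfderiv
    have h3 : mfderiv 𝓘(ℝ, ℝ) I' γ 0 = mfderiv 𝓘(ℝ, ℝ) I' (F ∘ fun t => K (γ t)) 0 :=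
      heq.mfderiv_eq
    have h4 := (DFunLike.congr_fun h3 (1 : ℝ)).trans (DFunLike.congr_fun h2 (1 : ℝ))
    exact (congrArg ξ h4).trans (h _)

end Conormal

/-! ### Conormal covectors of the graph of an action -/

section GraphOfAction

variable {EG : Type*} [NormedAddCommGroup EG] [NormedSpace ℝ EG]
  {G : Type*} [TopologicalSpace G] [ChartedSpace EG G]
  {ES : Type*} [NormedAddCommGroup ES] [NormedSpace ℝ ES]
  {S : Type*} [TopologicalSpace S] [ChartedSpace ES S]
  {EX : Type*} [NormedAddCommGroup EX] [NormedSpace ℝ EX]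
  {X : Type*} [TopologicalSpace X] [ChartedSpace EX X]

/-- The conormal covectors of the graph `{((g, J x), x, Φ (g, x))}`: they are determined by their
components on `S` and on the second factor `X`. -/
theorem isConormal_graph_iff [IsManifold 𝓘(ℝ, EG) ∞ G] [IsManifold 𝓘(ℝ, EX) ∞ X]
    {Φ : G × X → X} {J : X → S}
    (hΦ : ContMDiff (𝓘(ℝ, EG).prod 𝓘(ℝ, EX)) 𝓘(ℝ, EX) ∞ Φ)
    (hJ : ContMDiff 𝓘(ℝ, EX) 𝓘(ℝ, ES) ∞ J) (q : G × X)
    (ξ : Covector ((𝓘(ℝ, EG).prod 𝓘(ℝ, ES)).prod (𝓘(ℝ, EX).prod 𝓘(ℝ, EX)))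
      (((q.1, J q.2), (q.2, Φ q)) : (G × S) × (X × X))) :
    IsConormal ((𝓘(ℝ, EG).prod 𝓘(ℝ, ES)).prod (𝓘(ℝ, EX).prod 𝓘(ℝ, EX)))
        (Set.range fun q : G × X => (((q.1, J q.2), (q.2, Φ q)) : (G × S) × (X × X)))
        ((q.1, J q.2), (q.2, Φ q)) ξ ↔
      covFst _ (covFst _ ξ) = -covFst q (transpose
          (mfderiv (𝓘(ℝ, EG).prod 𝓘(ℝ, EX)) 𝓘(ℝ, EX) Φ q) (covSnd _ (covSnd _ ξ))) ∧
      covFst _ (covSnd _ ξ) = -transpose (mfderiv 𝓘(ℝ, EX) 𝓘(ℝ, ES) J q.2) (covSnd _ (covFst _ ξ))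
        - covSnd q (transpose
          (mfderiv (𝓘(ℝ, EG).prod 𝓘(ℝ, EX)) 𝓘(ℝ, EX) Φ q) (covSnd _ (covSnd _ ξ))) := by
  have hF : ContMDiff (𝓘(ℝ, EG).prod 𝓘(ℝ, EX))
      ((𝓘(ℝ, EG).prod 𝓘(ℝ, ES)).prod (𝓘(ℝ, EX).prod 𝓘(ℝ, EX))) ∞
      (fun q : G × X => (((q.1, J q.2), (q.2, Φ q)) : (G × S) × (X × X))) :=
    (contMDiff_fst.prodMk (hJ.comp contMDiff_snd)).prodMk (contMDiff_snd.prodMk hΦ)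
  have hK : ContMDiff ((𝓘(ℝ, EG).prod 𝓘(ℝ, ES)).prod (𝓘(ℝ, EX).prod 𝓘(ℝ, EX)))
      (𝓘(ℝ, EG).prod 𝓘(ℝ, EX)) ∞ (fun p : (G × S) × (X × X) => (p.1.1, p.2.1)) :=
    (contMDiff_fst.comp contMDiff_fst).prodMk (contMDiff_fst.comp contMDiff_snd)
  refine (isConormal_range_iff hF hK (fun _ => rfl) q ξ).trans ?_
  have hdF := ((hasMFDerivAt_fst (I := 𝓘(ℝ, EG)) (I' := 𝓘(ℝ, EX)) q).prodMk
      ((hJ.mdifferentiableAt (x := q.2) (by simp)).hasMFDerivAt.comp q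
        (hasMFDerivAt_snd q))).prodMk
    ((hasMFDerivAt_snd (I := 𝓘(ℝ, EG)) (I' := 𝓘(ℝ, EX)) q).prodMk
      (hΦ.mdifferentiableAt (x := q) (by simp)).hasMFDerivAt)
  have hd : ∀ (v : EG) (w : EX), mfderiv (𝓘(ℝ, EG).prod 𝓘(ℝ, EX))
      ((𝓘(ℝ, EG).prod 𝓘(ℝ, ES)).prod (𝓘(ℝ, EX).prod 𝓘(ℝ, EX)))
      (fun q : G × X => (((q.1, J q.2), (q.2, Φ q)) : (G × S) × (X × X))) q ((v, w) : EG × EX)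
      = (((v, mfderiv 𝓘(ℝ, EX) 𝓘(ℝ, ES) J q.2 w), (w,
        mfderiv (𝓘(ℝ, EG).prod 𝓘(ℝ, EX)) 𝓘(ℝ, EX) Φ q ((v, w) : EG × EX))) :
          (EG × ES) × (EX × EX)) :=
    fun v w => DFunLike.congr_fun hdF.mfderiv ((v, w) : EG × EX)
  -- The two derivatives and the covector are given opaque names typed over the model spaces, so
  -- that the rest is linear algebra in plain products.
  obtain ⟨A, hA⟩ : ∃ A : EG × EX →L[ℝ] EX,
    A = mfderiv (𝓘(ℝ, EG).prod 𝓘(ℝ, EX)) 𝓘(ℝ, EX) Φ q := ⟨_, rfl⟩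
  obtain ⟨B, hB⟩ : ∃ B : EX →L[ℝ] ES, B = mfderiv 𝓘(ℝ, EX) 𝓘(ℝ, ES) J q.2 := ⟨_, rfl⟩
  obtain ⟨ζ, hζ⟩ : ∃ ζ : (EG × ES) × (EX × EX) →L[ℝ] ℝ, ζ = ξ := ⟨_, rfl⟩
  -- Testing on `(v, 0)` fixes the `G`-component and testing on `(0, w)` fixes the first
  -- `X`-component; by linearity these tests suffice.
  have hlin : (∀ (v : EG) (w : EX), ζ ((v, B w), (w, A (v, w))) = 0) ↔
      (∀ v : EG, ζ ((v, 0), (0, 0)) = -ζ ((0, 0), (0, A (v, 0)))) ∧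
      (∀ w : EX, ζ ((0, 0), (w, 0)) = -ζ ((0, B w), (0, 0)) - ζ ((0, 0), (0, A (0, w)))) := by
    have hsplit : ∀ (v : EG) (w : EX), ζ ((v, B w), (w, A (v, w))) =
        (ζ ((v, 0), (0, 0)) + ζ ((0, 0), (0, A (v, 0)))) +
        (ζ ((0, 0), (w, 0)) + ζ ((0, B w), (0, 0)) + ζ ((0, 0), (0, A (0, w)))) := by
      intro v w
      simp only [← map_add]
      congr 1
      simp [← map_add]
    have hζ0 : ζ ((0, 0), (0, 0)) = 0 := map_zero ζ
    have hA0 : A (0, 0) = 0 := map_zero A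
    constructor
    · intro h
      refine ⟨fun v => ?_, fun w => ?_⟩
      · have := hsplit v 0
        rw [h, map_zero B, hA0, hζ0] at this
        linarith
      · have := hsplit 0 w
        rw [h, hA0, hζ0] at this
        linarith
    · rintro ⟨h1, h2⟩ v w
      rw [hsplit, h1, h2]
      ring
  subst hζ hA hB
  constructor
  · intro h
    have h' := hlin.1 fun v w => (congrArg ζ (hd v w)).symm.trans (h ((v, w) : EG × EX))
    exact ⟨ContinuousLinearMap.ext h'.1, ContinuousLinearMap.ext h'.2⟩
  · rintro ⟨h1, h2⟩ v
    have h' := hlin.2 ⟨fun v => DFunLike.congr_fun h1 v, fun w => DFunLike.congr_fun h2 w⟩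
    exact (congrArg ζ (hd v.1 v.2)).trans (h' v.1 v.2)

end GraphOfAction

/-! ### Linear algebra of covectors and of the duality between `𝔤` and `𝔥` -/

theorem IsBivectorField.neg_swap {E : Type*} [NormedAddCommGroup E] [NormedSpace ℝ E]
    {H : Type*} [TopologicalSpace H] {I : ModelWithCorners ℝ E H}
    {M : Type*} [TopologicalSpace M] [ChartedSpace H M] {P : TwoTensorField I M}
    (hP : IsBivectorField I P) (x : M) (ξ η : Covector I x) : P x ξ η = -P x η ξ := by
  have h := hP.alternating x (ξ + η)
  simp only [map_add, LinearMap.add_apply, hP.alternating] at h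
  linarith

theorem exists_covector_prod {E : Type*} [NormedAddCommGroup E] [NormedSpace ℝ E]
    {H : Type*} [TopologicalSpace H] {I : ModelWithCorners ℝ E H}
    {M : Type*} [TopologicalSpace M] [ChartedSpace H M]
    {E' : Type*} [NormedAddCommGroup E'] [NormedSpace ℝ E']
    {H' : Type*} [TopologicalSpace H'] {I' : ModelWithCorners ℝ E' H'}
    {M' : Type*} [TopologicalSpace M'] [ChartedSpace H' M'] (p : M × M')
    (a : Covector I p.1) (b : Covector I' p.2) :
    ∃ ξ : Covector (I.prod I') p, covFst p ξ = a ∧ covSnd p ξ = b :=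
  ⟨ContinuousLinearMap.coprod (a : E →L[ℝ] ℝ) (b : E' →L[ℝ] ℝ),
    ContinuousLinearMap.coprod_comp_inl (a : E →L[ℝ] ℝ) (b : E' →L[ℝ] ℝ),
    ContinuousLinearMap.coprod_comp_inr (a : E →L[ℝ] ℝ) (b : E' →L[ℝ] ℝ)⟩

namespace ManinQuasiTriple

variable {𝔡 : Type*} [LieRing 𝔡] [LieAlgebra ℝ 𝔡] (T : ManinQuasiTriple 𝔡)
  [FiniteDimensional ℝ 𝔡]

theorem pairing_dualEquiv (a : Module.Dual ℝ T.g) (ξ : T.g) :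
    T.pairing ξ (T.dualEquiv a) = a ξ :=
  LinearMap.congr_fun (T.pairing.flip.toPerfPair.apply_symm_apply a) ξ

theorem pairing_dualEquiv' (b : Module.Dual ℝ T.h) (η : T.h) :
    T.pairing (T.dualEquiv' b) η = b η :=
  LinearMap.congr_fun (T.pairing.toPerfPair.apply_symm_apply b) η

/-- Both sides are the pairing of `T.dualEquiv' b` with `T.dualEquiv a`: the two identifications
come from the same form and are transposes of each other. -/
theorem apply_dualEquiv (a : Module.Dual ℝ T.g) (b : Module.Dual ℝ T.h) :
    b (T.dualEquiv a) = a (T.dualEquiv' b) := by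
  rw [← T.pairing_dualEquiv', T.pairing_dualEquiv]

end ManinQuasiTriple

/-! ### Coisotropy of the graph in terms of the `G`-action -/

namespace GroupPair

variable {𝔡 : Type*} [LieRing 𝔡] [LieAlgebra ℝ 𝔡] {T : ManinQuasiTriple 𝔡}
  {ED : Type*} [NormedAddCommGroup ED] [NormedSpace ℝ ED]
  {D : Type*} [Group D] [TopologicalSpace D] [ChartedSpace ED D]
  {EG : Type*} [NormedAddCommGroup EG] [NormedSpace ℝ EG]
  {G : Type*} [Group G] [TopologicalSpace G] [ChartedSpace EG G]
  (P : GroupPair T ED D EG G)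
  {ES : Type*} [NormedAddCommGroup ES] [NormedSpace ℝ ES] [ChartedSpace ES P.S]
  {EX : Type*} [NormedAddCommGroup EX] [NormedSpace ℝ EX]
  {X : Type*} [TopologicalSpace X] [ChartedSpace EX X]

/-- The momentum map intertwines the infinitesimal actions. -/
theorem mfderiv_infGenerator [LieGroup 𝓘(ℝ, ED) ∞ D] [LieGroup 𝓘(ℝ, EG) ∞ G]
    [IsManifold 𝓘(ℝ, ES) ∞ P.S]
    (hS : Manifold.IsSubmersion 𝓘(ℝ, ED) 𝓘(ℝ, ES) ∞ (QuotientGroup.mk : D → P.S))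
    {Φ : G → X → X} {J : X → P.S}
    (hΦ : ContMDiff (𝓘(ℝ, EG).prod 𝓘(ℝ, EX)) 𝓘(ℝ, EX) ∞ (fun p : G × X => Φ p.1 p.2))
    (h1 : ∀ x, Φ 1 x = x) (hJ : ContMDiff 𝓘(ℝ, EX) 𝓘(ℝ, ES) ∞ J)
    (hJΦ : ∀ g x, J (Φ g x) = P.ι g • J x) (x : X) (ξ : T.g) :
    mfderiv 𝓘(ℝ, EX) 𝓘(ℝ, ES) J x (P.infGenerator Φ x ξ) = P.dressing (J x) ξ := by
  have hΦx : ContMDiff 𝓘(ℝ, EG) 𝓘(ℝ, EX) ∞ (fun g : G => Φ g x) :=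
    hΦ.comp (contMDiff_id.prodMk contMDiff_const)
  have hDx : ContMDiff 𝓘(ℝ, ED) 𝓘(ℝ, ES) ∞ (fun d : D => d • J x) :=
    (P.contMDiff_action hS).comp (contMDiff_id.prodMk contMDiff_const)
  -- The map `g ↦ J(Φ(g, x)) = ι(g) J(x)` is differentiated at `1` twice, once through `X` and once
  -- through `D`; uniqueness of derivatives gives the claim.
  have e1 : HasMFDerivAt 𝓘(ℝ, EG) 𝓘(ℝ, ES) (J ∘ fun g : G => Φ g x) 1
      ((mfderiv 𝓘(ℝ, EX) 𝓘(ℝ, ES) J x).comp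
        (mfderiv 𝓘(ℝ, EG) 𝓘(ℝ, EX) (fun g : G => Φ g x) 1)) := by
    refine HasMFDerivAt.comp (1 : G) ?_ (hΦx.mdifferentiableAt (by simp)).hasMFDerivAt
    rw [h1]
    exact (hJ.mdifferentiableAt (by simp)).hasMFDerivAt
  have e2 : HasMFDerivAt 𝓘(ℝ, EG) 𝓘(ℝ, ES) ((fun d : D => d • J x) ∘ P.ι) 1
      ((mfderiv 𝓘(ℝ, ED) 𝓘(ℝ, ES) (fun d : D => d • J x) 1).comp
        (mfderiv 𝓘(ℝ, EG) 𝓘(ℝ, ED) P.ι 1)) := by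
    refine HasMFDerivAt.comp (1 : G) ?_ (P.smooth_ι.mdifferentiableAt (by simp)).hasMFDerivAt
    rw [map_one]
    exact (hDx.mdifferentiableAt (by simp)).hasMFDerivAt
  have e3 : (J ∘ fun g : G => Φ g x) = (fun d : D => d • J x) ∘ P.ι := funext fun g => hJΦ g x
  rw [e3] at e1
  have e4 := DFunLike.congr_fun (hasMFDerivAt_unique e1 e2) (P.lieG ξ)
  refine e4.trans ?_
  exact congrArg (mfderiv 𝓘(ℝ, ED) 𝓘(ℝ, ES) (fun d : D => d • J x) 1) (P.deriv_ι ξ)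

/-- For the orbit map `Φ_x` and the diffeomorphism `Φ_g` of `X`, one has
`L_g^* Φ_x^* ψ = ⟨Φ_g^* ψ, (·)_X⟩`. -/
theorem coLeftG_covFst_transpose [LieGroup 𝓘(ℝ, EG) ∞ G] {Φ : G → X → X}
    (hΦ : ContMDiff (𝓘(ℝ, EG).prod 𝓘(ℝ, EX)) 𝓘(ℝ, EX) ∞ (fun p : G × X => Φ p.1 p.2))
    (h1 : ∀ x, Φ 1 x = x) (hmul : ∀ g h x, Φ (g * h) x = Φ g (Φ h x)) (q : G × X)
    (ψ : Covector 𝓘(ℝ, EX) (Φ q.1 q.2)) (ξ : T.g) :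
    P.coLeftG q.1 (covFst q (transpose (mfderiv (𝓘(ℝ, EG).prod 𝓘(ℝ, EX)) 𝓘(ℝ, EX)
        (fun p : G × X => Φ p.1 p.2) q) ψ)) ξ =
      covSnd q (transpose (mfderiv (𝓘(ℝ, EG).prod 𝓘(ℝ, EX)) 𝓘(ℝ, EX)
        (fun p : G × X => Φ p.1 p.2) q) ψ) (P.infGenerator Φ q.2 ξ) := by
  obtain ⟨g, x⟩ := q
  have hΦx : ContMDiff 𝓘(ℝ, EG) 𝓘(ℝ, EX) ∞ (fun g : G => Φ g x) :=
    hΦ.comp (contMDiff_id.prodMk contMDiff_const)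
  have hL : ContMDiff 𝓘(ℝ, EG) 𝓘(ℝ, EG) ∞ (fun b : G => g * b) := contMDiff_mul_left
  have hΦ' := (hΦ.mdifferentiableAt (x := (g, x)) (by simp)).hasMFDerivAt
  -- The identity `Φ(gb, x) = Φ(g, Φ(b, x))` is differentiated in `b` at `1`: the left side moves
  -- only the `G`-argument, the right side only the `X`-argument.
  have e1 : HasMFDerivAt 𝓘(ℝ, EG) 𝓘(ℝ, EX)
      ((fun p : G × X => Φ p.1 p.2) ∘ fun b : G => (g * b, x)) 1
      ((mfderiv (𝓘(ℝ, EG).prod 𝓘(ℝ, EX)) 𝓘(ℝ, EX) (fun p : G × X => Φ p.1 p.2) (g, x)).comp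
        ((mfderiv 𝓘(ℝ, EG) 𝓘(ℝ, EG) (fun b : G => g * b) 1).prod 0)) := by
    refine HasMFDerivAt.comp (1 : G) ?_
      ((hL.mdifferentiableAt (by simp)).hasMFDerivAt.prodMk (hasMFDerivAt_const (I' := 𝓘(ℝ, EX)) x 1))
    rw [mul_one]
    exact hΦ'
  have e2 : HasMFDerivAt 𝓘(ℝ, EG) 𝓘(ℝ, EX)
      ((fun p : G × X => Φ p.1 p.2) ∘ fun b : G => (g, Φ b x)) 1
      ((mfderiv (𝓘(ℝ, EG).prod 𝓘(ℝ, EX)) 𝓘(ℝ, EX) (fun p : G × X => Φ p.1 p.2) (g, x)).comp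
        ((0 : EG →L[ℝ] EG).prod (mfderiv 𝓘(ℝ, EG) 𝓘(ℝ, EX) (fun g : G => Φ g x) 1))) := by
    refine HasMFDerivAt.comp (1 : G) ?_
      ((hasMFDerivAt_const (I := 𝓘(ℝ, EG)) (I' := 𝓘(ℝ, EG)) g (1 : G)).prodMk (hΦx.mdifferentiableAt (by simp)).hasMFDerivAt)
    rw [h1]
    exact hΦ'
  have e3 : ((fun p : G × X => Φ p.1 p.2) ∘ fun b : G => (g * b, x)) =
      (fun p : G × X => Φ p.1 p.2) ∘ fun b : G => (g, Φ b x) := funext fun b => hmul g b x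
  rw [e3] at e1
  exact congrArg ψ (DFunLike.congr_fun (hasMFDerivAt_unique e1 e2) (P.lieG ξ))

/-- The derivative of `Φ` at `(1, x)` along `X` is the identity, so that every covector at `x` is a
pullback. -/
theorem exists_covSnd_transpose_one_eq {Φ : G → X → X}
    (hΦ : ContMDiff (𝓘(ℝ, EG).prod 𝓘(ℝ, EX)) 𝓘(ℝ, EX) ∞ (fun p : G × X => Φ p.1 p.2))
    (h1 : ∀ x, Φ 1 x = x) (x : X) (ψ : Covector 𝓘(ℝ, EX) x) :
    ∃ ψ' : Covector 𝓘(ℝ, EX) (Φ 1 x),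
      covSnd ((1 : G), x) (transpose (mfderiv (𝓘(ℝ, EG).prod 𝓘(ℝ, EX)) 𝓘(ℝ, EX)
        (fun p : G × X => Φ p.1 p.2) (1, x)) ψ') = ψ := by
  have e1 := ((hΦ.mdifferentiableAt (x := ((1 : G), x)) (by simp)).hasMFDerivAt).comp x
    ((hasMFDerivAt_const (I := 𝓘(ℝ, EX)) (I' := 𝓘(ℝ, EG)) (1 : G) x).prodMk
      (hasMFDerivAt_id x))
  have e1' := e1.congr_of_eventuallyEq (f₁ := id) (Filter.Eventually.of_forall fun y => (h1 y).symm)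
  have e3 : ∀ w : EX, mfderiv (𝓘(ℝ, EG).prod 𝓘(ℝ, EX)) 𝓘(ℝ, EX)
      (fun p : G × X => Φ p.1 p.2) (1, x) ((0, w) : EG × EX) = w := by
    intro w
    exact DFunLike.congr_fun (hasMFDerivAt_unique e1' (hasMFDerivAt_id x)) w
  -- The tangent spaces at `Φ 1 x` and at `x` are both the model space, so `ψ` can be reused at the
  -- other point.
  let ψ' : EX →L[ℝ] ℝ := ψ
  exact ⟨ψ', ContinuousLinearMap.ext fun w => congrArg ψ' (e3 w)⟩

variable [FiniteDimensional ℝ 𝔡]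

/-- `λ` is the transpose of the dressing action restricted to `𝔥 ≅ 𝔤^*`. This moves the mixed term
of `Π` from a vector on `S` to the element `λ(θ)` of `𝔤`, where it can meet the generators on `X`.
-/
theorem cross_apply (g : G) (s : P.S) (θg : Covector 𝓘(ℝ, EG) g) (θ : Covector 𝓘(ℝ, ES) s) :
    P.cross g s θg θ = P.coLeftG g θg (P.lam s θ) :=
  T.apply_dualEquiv (P.coLeftG g θg) (P.coDress s θ)

theorem PiS_apply (s : P.S) (θ θ' : Covector 𝓘(ℝ, ES) s) :
    P.PiS s θ θ' = -θ' (P.dressing s (P.lam s θ)) := rfl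

/-- The value of `Π ⊕ PX ⊕ -PX` on two conormal covectors of the graph of an action, in terms of
their components `θ`, `ψ` on `S` and on the second factor `X`. -/
theorem directSum_conormal_apply [LieGroup 𝓘(ℝ, EG) ∞ G] {Φ : G → X → X} {J : X → P.S}
    {PX : TwoTensorField 𝓘(ℝ, EX) X} (hPX : IsBivectorField 𝓘(ℝ, EX) PX)
    (hΦ : ContMDiff (𝓘(ℝ, EG).prod 𝓘(ℝ, EX)) 𝓘(ℝ, EX) ∞ (fun p : G × X => Φ p.1 p.2))
    (h1 : ∀ x, Φ 1 x = x) (hmul : ∀ g h x, Φ (g * h) x = Φ g (Φ h x)) (q : G × X)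
    (A : Covector 𝓘(ℝ, EX) (Φ q.1 q.2) →ₗ[ℝ] Covector (𝓘(ℝ, EG).prod 𝓘(ℝ, EX)) q)
    (hA : A = transpose (mfderiv (𝓘(ℝ, EG).prod 𝓘(ℝ, EX)) 𝓘(ℝ, EX)
      (fun p : G × X => Φ p.1 p.2) q))
    (B : Covector 𝓘(ℝ, ES) (J q.2) →ₗ[ℝ] Covector 𝓘(ℝ, EX) q.2)
    (ξ ξ' : Covector ((𝓘(ℝ, EG).prod 𝓘(ℝ, ES)).prod (𝓘(ℝ, EX).prod 𝓘(ℝ, EX)))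
      (((q.1, J q.2), (q.2, Φ q.1 q.2)) : (G × P.S) × (X × X)))
    {θ θ' : Covector 𝓘(ℝ, ES) (J q.2)} {ψ ψ' : Covector 𝓘(ℝ, EX) (Φ q.1 q.2)}
    (hθ : covSnd _ (covFst _ ξ) = θ) (hψ : covSnd _ (covSnd _ ξ) = ψ)
    (hθ' : covSnd _ (covFst _ ξ') = θ') (hψ' : covSnd _ (covSnd _ ξ') = ψ')
    (hg : covFst _ (covFst _ ξ) = -covFst q (A ψ))
    (hx : covFst _ (covSnd _ ξ) = -B θ - covSnd q (A ψ))
    (hg' : covFst _ (covFst _ ξ') = -covFst q (A ψ'))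
    (hx' : covFst _ (covSnd _ ξ') = -B θ' - covSnd q (A ψ')) :
    directSum P.PiGroupoid (directSum PX (-PX))
        (((q.1, J q.2), (q.2, Φ q.1 q.2)) : (G × P.S) × (X × X)) ξ ξ' =
      (directSum (I := 𝓘(ℝ, EG)) (I' := 𝓘(ℝ, EX)) P.PiG PX q (A ψ) (A ψ') - PX (Φ q.1 q.2) ψ ψ') +
      (PX q.2 (B θ) (covSnd q (A ψ')) +
        covSnd q (A ψ') (P.infGenerator Φ q.2 (P.lam (J q.2) θ))) -
      (PX q.2 (B θ') (covSnd q (A ψ)) +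
        covSnd q (A ψ) (P.infGenerator Φ q.2 (P.lam (J q.2) θ'))) +
      (PX q.2 (B θ) (B θ') + θ' (P.dressing (J q.2) (P.lam (J q.2) θ))) := by
  -- Only here does it matter that `A` is the transpose of the derivative of the action; the rest of
  -- the computation is bilinear in arbitrary maps `A` and `B`.
  have hc : ∀ (ψ : Covector 𝓘(ℝ, EX) (Φ q.1 q.2)) (θ : Covector 𝓘(ℝ, ES) (J q.2)),
      P.cross q.1 (J q.2) (covFst q (A ψ)) θ =
        covSnd q (A ψ) (P.infGenerator Φ q.2 (P.lam (J q.2) θ)) := by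
    intro ψ θ
    rw [P.cross_apply, hA]
    exact P.coLeftG_covFst_transpose hΦ h1 hmul q ψ _
  have hsum : directSum P.PiGroupoid (directSum PX (-PX))
      (((q.1, J q.2), (q.2, Φ q.1 q.2)) : (G × P.S) × (X × X)) ξ ξ' =
      (P.PiG q.1 (covFst (q.1, J q.2) (covFst _ ξ)) (covFst (q.1, J q.2) (covFst _ ξ'))
        - P.PiS (J q.2) (covSnd (q.1, J q.2) (covFst _ ξ)) (covSnd (q.1, J q.2) (covFst _ ξ'))
        + P.cross q.1 (J q.2) (covFst (q.1, J q.2) (covFst _ ξ))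
          (covSnd (q.1, J q.2) (covFst _ ξ'))
        - P.cross q.1 (J q.2) (covFst (q.1, J q.2) (covFst _ ξ'))
          (covSnd (q.1, J q.2) (covFst _ ξ)))
      + (PX q.2 (covFst (q.2, Φ q.1 q.2) (covSnd _ ξ)) (covFst (q.2, Φ q.1 q.2) (covSnd _ ξ'))
        + -PX (Φ q.1 q.2) (covSnd (q.2, Φ q.1 q.2) (covSnd _ ξ))
          (covSnd (q.2, Φ q.1 q.2) (covSnd _ ξ'))) := rfl
  have hsum' : directSum (I := 𝓘(ℝ, EG)) (I' := 𝓘(ℝ, EX)) P.PiG PX q (A ψ) (A ψ') = P.PiG q.1 (covFst q (A ψ)) (covFst q (A ψ'))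
      + PX q.2 (covSnd q (A ψ)) (covSnd q (A ψ')) := rfl
  rw [hsum, hsum', hθ, hψ, hθ', hψ', hg, hx, hg', hx', P.PiS_apply]
  simp only [map_neg, map_sub, LinearMap.neg_apply, LinearMap.sub_apply, hc]
  -- Skew-symmetry brings the second mixed term into the shape `PX (B _) _` of the first, so that
  -- both are instances of the momentum condition.
  rw [hPX.neg_swap q.2 (covSnd q (A ψ)) (B θ')]
  ring

/-- The graph of an action is coisotropic iff the action is quasi-Poisson with momentum map `J`. -/
theorem isCoisotropic_graph_iff [LieGroup 𝓘(ℝ, ED) ∞ D] [LieGroup 𝓘(ℝ, EG) ∞ G]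
    [IsManifold 𝓘(ℝ, ES) ∞ P.S] [IsManifold 𝓘(ℝ, EX) ∞ X]
    (hS : Manifold.IsSubmersion 𝓘(ℝ, ED) 𝓘(ℝ, ES) ∞ (QuotientGroup.mk : D → P.S))
    {Φ : G → X → X} {J : X → P.S} {PX : TwoTensorField 𝓘(ℝ, EX) X}
    (hPX : IsBivectorField 𝓘(ℝ, EX) PX)
    (hΦ : ContMDiff (𝓘(ℝ, EG).prod 𝓘(ℝ, EX)) 𝓘(ℝ, EX) ∞ (fun p : G × X => Φ p.1 p.2))
    (h1 : ∀ x, Φ 1 x = x) (hmul : ∀ g h x, Φ (g * h) x = Φ g (Φ h x))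
    (hJ : ContMDiff 𝓘(ℝ, EX) 𝓘(ℝ, ES) ∞ J) (hJΦ : ∀ g x, J (Φ g x) = P.ι g • J x) :
    IsCoisotropic ((𝓘(ℝ, EG).prod 𝓘(ℝ, ES)).prod (𝓘(ℝ, EX).prod 𝓘(ℝ, EX)))
        (directSum P.PiGroupoid (directSum PX (-PX)))
        (Set.range fun q : G × X => (((q.1, J q.2), (q.2, Φ q.1 q.2)) : (G × P.S) × (X × X))) ↔
      PushesForward (fun p : G × X => Φ p.1 p.2) (directSum P.PiG PX) PX ∧
      ∀ (x : X) (θ : Covector 𝓘(ℝ, ES) (J x)) (ψ : Covector 𝓘(ℝ, EX) x),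
        PX x (transpose (mfderiv 𝓘(ℝ, EX) 𝓘(ℝ, ES) J x) θ) ψ
          = -ψ (P.infGenerator Φ x (P.lam (J x) θ)) := by
  constructor
  · intro h
    -- The pair `(θ, ψ)` is arbitrary, so the terms of the coisotropy identity can be isolated by
    -- setting parameters to zero.
    have hex : ∀ (q : G × X) (θ : Covector 𝓘(ℝ, ES) (J q.2)) (ψ : Covector 𝓘(ℝ, EX) (Φ q.1 q.2)),
        ∃ ξ : Covector ((𝓘(ℝ, EG).prod 𝓘(ℝ, ES)).prod (𝓘(ℝ, EX).prod 𝓘(ℝ, EX)))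
          (((q.1, J q.2), (q.2, Φ q.1 q.2)) : (G × P.S) × (X × X)),
          covSnd _ (covFst _ ξ) = θ ∧ covSnd _ (covSnd _ ξ) = ψ ∧
          covFst _ (covFst _ ξ) = -covFst q (transpose
            (mfderiv (𝓘(ℝ, EG).prod 𝓘(ℝ, EX)) 𝓘(ℝ, EX) (fun p : G × X => Φ p.1 p.2) q) ψ) ∧
          covFst _ (covSnd _ ξ) = -transpose (mfderiv 𝓘(ℝ, EX) 𝓘(ℝ, ES) J q.2) θ
            - covSnd q (transpose
            (mfderiv (𝓘(ℝ, EG).prod 𝓘(ℝ, EX)) 𝓘(ℝ, EX) (fun p : G × X => Φ p.1 p.2) q) ψ) := by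
      intro q θ ψ
      obtain ⟨ξ₁, h11, h12⟩ := exists_covector_prod (q.1, J q.2) (-covFst q (transpose
            (mfderiv (𝓘(ℝ, EG).prod 𝓘(ℝ, EX)) 𝓘(ℝ, EX) (fun p : G × X => Φ p.1 p.2) q) ψ)) θ
      obtain ⟨ξ₂, h21, h22⟩ := exists_covector_prod (q.2, Φ q.1 q.2)
        (-transpose (mfderiv 𝓘(ℝ, EX) 𝓘(ℝ, ES) J q.2) θ - covSnd q (transpose
            (mfderiv (𝓘(ℝ, EG).prod 𝓘(ℝ, EX)) 𝓘(ℝ, EX) (fun p : G × X => Φ p.1 p.2) q) ψ)) ψ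
      obtain ⟨ξ, rfl, rfl⟩ := exists_covector_prod
        (((q.1, J q.2), (q.2, Φ q.1 q.2)) : (G × P.S) × (X × X)) ξ₁ ξ₂
      exact ⟨ξ, h12, h22, h11, h21⟩
    have key : ∀ (q : G × X) (θ θ' : Covector 𝓘(ℝ, ES) (J q.2))
        (ψ ψ' : Covector 𝓘(ℝ, EX) (Φ q.1 q.2)),
        let A := transpose (mfderiv (𝓘(ℝ, EG).prod 𝓘(ℝ, EX)) 𝓘(ℝ, EX)
          (fun p : G × X => Φ p.1 p.2) q)
        let B := transpose (mfderiv 𝓘(ℝ, EX) 𝓘(ℝ, ES) J q.2)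
        (directSum (I := 𝓘(ℝ, EG)) (I' := 𝓘(ℝ, EX)) P.PiG PX q (A ψ) (A ψ')
            - PX (Φ q.1 q.2) ψ ψ') +
          (PX q.2 (B θ) (covSnd q (A ψ')) +
            covSnd q (A ψ') (P.infGenerator Φ q.2 (P.lam (J q.2) θ))) -
          (PX q.2 (B θ') (covSnd q (A ψ)) +
            covSnd q (A ψ) (P.infGenerator Φ q.2 (P.lam (J q.2) θ'))) +
          (PX q.2 (B θ) (B θ') + θ' (P.dressing (J q.2) (P.lam (J q.2) θ))) = 0 := by
      intro q θ θ' ψ ψ'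
      obtain ⟨ξ, hθ, hψ, hg, hx⟩ := hex q θ ψ
      obtain ⟨ξ', hθ', hψ', hg', hx'⟩ := hex q θ' ψ'
      have h' := h _ ⟨q, rfl⟩ ξ ξ'
        ((isConormal_graph_iff hΦ hJ q ξ).2 (by rw [hθ, hψ]; exact ⟨hg, hx⟩))
        ((isConormal_graph_iff hΦ hJ q ξ').2 (by rw [hθ', hψ']; exact ⟨hg', hx'⟩))
      exact (P.directSum_conormal_apply hPX hΦ h1 hmul q _ rfl
        (transpose (mfderiv 𝓘(ℝ, EX) 𝓘(ℝ, ES) J q.2)) ξ ξ' hθ hψ hθ' hψ' hg hx hg' hx').symm.trans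
          h'
    refine ⟨fun q ψ ψ' => ?_, fun x θ ψ => ?_⟩
    · have h' := key q 0 0 ψ ψ'
      dsimp only at h'
      simp only [map_zero, LinearMap.zero_apply, zero_apply, add_zero,
        sub_zero] at h'
      exact sub_eq_zero.1 h'
    -- Points with `g = 1` already give the full momentum condition, since every covector at `x` is
    -- a pullback under `Φ_1`.
    · obtain ⟨ψ', hψ'⟩ := exists_covSnd_transpose_one_eq hΦ h1 x ψ
      have h' := key (1, x) θ 0 0 ψ'
      dsimp only at h'
      rw [hψ'] at h'
      simp only [map_zero, LinearMap.zero_apply, zero_apply, add_zero,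
        sub_zero, zero_add] at h'
      exact eq_neg_of_add_eq_zero_left h'
  · rintro ⟨hpush, hmom⟩ p ⟨q, rfl⟩ ξ ξ' hξ hξ'
    obtain ⟨hg, hx⟩ := (isConormal_graph_iff hΦ hJ q ξ).1 hξ
    obtain ⟨hg', hx'⟩ := (isConormal_graph_iff hΦ hJ q ξ').1 hξ'
    refine (P.directSum_conormal_apply hPX hΦ h1 hmul q _ rfl
      (transpose (mfderiv 𝓘(ℝ, EX) 𝓘(ℝ, ES) J q.2)) ξ ξ' rfl rfl rfl rfl hg hx hg' hx').trans ?_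
    rw [hmom, hmom, hmom]
    have hp := hpush q (covSnd _ (covSnd _ ξ)) (covSnd _ (covSnd _ ξ'))
    -- After the momentum condition, the `θθ'` term compares the image of `λ(θ)_X` under the
    -- derivative of `J` with `λ(θ)_S`; infinitesimal equivariance identifies the two.
    have hd := congrArg (covSnd _ (covFst _ ξ'))
      (P.mfderiv_infGenerator hS hΦ h1 hJ hJΦ q.2 (P.lam (J q.2) (covSnd _ (covFst _ ξ))))
    rw [sub_eq_zero.2 hp]
    change _ = (covSnd _ (covFst _ ξ')) _ at hd
    rw [← hd]
    change 0 + (-_ + _) - (-_ + _) + (-_ + _) = (0 : ℝ)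
    simp only [neg_add_cancel, add_zero, sub_zero, zero_add]
    exact neg_add_cancel _

end GroupPair

/-! ### Passing between `G`-actions and actions of the transformation groupoid -/

namespace GroupPair

variable {𝔡 : Type*} [LieRing 𝔡] [LieAlgebra ℝ 𝔡] {T : ManinQuasiTriple 𝔡}
  {ED : Type*} [NormedAddCommGroup ED] [NormedSpace ℝ ED]
  {D : Type*} [Group D] [TopologicalSpace D] [ChartedSpace ED D] [LieGroup 𝓘(ℝ, ED) ∞ D]
  {EG : Type*} [NormedAddCommGroup EG] [NormedSpace ℝ EG]
  {G : Type*} [Group G] [TopologicalSpace G] [ChartedSpace EG G] [LieGroup 𝓘(ℝ, EG) ∞ G]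
  (P : GroupPair T ED D EG G)
  {ES : Type*} [NormedAddCommGroup ES] [NormedSpace ℝ ES] [ChartedSpace ES P.S]
  [IsManifold 𝓘(ℝ, ES) ∞ P.S]
  (hS : Manifold.IsSubmersion 𝓘(ℝ, ED) 𝓘(ℝ, ES) ∞ (QuotientGroup.mk : D → P.S))

/-- In a composable pair the `S`-coordinate is forced to be `J x`, so the graph sees only the
restricted `G`-action and is parametrised by `G × X`. -/
theorem graph_eq_range {X : Type*} (J : X → P.S) (act : G × P.S → X → X) :
    (P.groupoid hS).graph J act = Set.range fun q : G × X =>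
      (((q.1, J q.2), (q.2, P.restrictAction J act q.1 q.2)) : (G × P.S) × (X × X)) := by
  ext ⟨⟨g, s⟩, x, y⟩
  constructor
  · rintro ⟨h1, h2⟩
    change J x = s at h1
    subst h1
    change y = act (g, J x) x at h2
    subst h2
    exact ⟨(g, x), rfl⟩
  · rintro ⟨⟨g', x'⟩, h⟩
    simp only [Prod.mk.injEq] at h
    obtain ⟨⟨rfl, rfl⟩, rfl, rfl⟩ := h
    exact ⟨rfl, rfl⟩

variable {EX : Type*} [NormedAddCommGroup EX] [NormedSpace ℝ EX]
  {X : Type*} [TopologicalSpace X] [ChartedSpace EX X]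

/-- Under `A = 𝔤 × S`, the infinitesimal action of the Lie algebroid is that of `𝔤`. -/
theorem infAction_toAlgebroid {J : X → P.S} {act : G × P.S → X → X}
    (h : (P.groupoid hS).IsGroupoidSpace 𝓘(ℝ, EX) J act) (x : X) (ξ : T.g) :
    (P.groupoid hS).infAction 𝓘(ℝ, EX) J act x (P.toAlgebroid hS (J x) ξ) =
      P.infGenerator (P.restrictAction J act) x ξ := by
  -- The action is smooth only within the `β`-fibre, where derivatives need not be unique. Composing
  -- with `g ↦ (g, J x)`, which maps all of `G` into the fibre, turns this into an ordinary, hence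
  -- unique, derivative on `G`.
  let U : Set (G × P.S) := {γ | (P.groupoid hS).β γ = J x}
  have hact : MDifferentiableWithinAt (𝓘(ℝ, EG).prod 𝓘(ℝ, ES)) 𝓘(ℝ, EX) (fun γ => act γ x) U
      ((1 : G), J x) := by
    have h1 := (h.smooth_act (((1 : G), J x), x) rfl).mdifferentiableWithinAt (by simp)
    exact h1.comp (s := U) (f := fun γ : G × P.S => (γ, x)) ((1 : G), J x)
      ((mdifferentiableAt_id (I := 𝓘(ℝ, EG).prod 𝓘(ℝ, ES))).prodMk
        mdifferentiableAt_const).mdifferentiableWithinAt fun γ hγ => hγ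
  have hi : HasMFDerivWithinAt 𝓘(ℝ, EG) (𝓘(ℝ, EG).prod 𝓘(ℝ, ES)) (fun g : G => (g, J x))
      Set.univ 1 ((ContinuousLinearMap.id ℝ EG).prod (0 : EG →L[ℝ] ES)) :=
    ((hasMFDerivAt_id (1 : G)).prodMk (hasMFDerivAt_const (J x) (1 : G))).hasMFDerivWithinAt
  have h2 := HasMFDerivWithinAt.comp (1 : G) (u := U) (g := fun γ => act γ x) hact.hasMFDerivWithinAt hi
    (fun g _ => (rfl : (P.groupoid hS).β (g, J x) = J x))
  rw [hasMFDerivWithinAt_univ] at h2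
  exact (DFunLike.congr_fun h2.mfderiv (P.lieG ξ)).symm

/-- Both trivectors evaluate `T.omega` on covectors pulled back to `𝔤`; the composite of `𝔤` into
the algebroid with the algebroid action is the generator map. -/
theorem hat_omegaSection [FiniteDimensional ℝ 𝔡] {J : X → P.S} {act : G × P.S → X → X}
    (h : (P.groupoid hS).IsGroupoidSpace 𝓘(ℝ, EX) J act) :
    (P.groupoid hS).hat 𝓘(ℝ, EX) J act (P.omegaSection hS) =
      P.omegaX (P.restrictAction J act) := by
  funext x
  ext θ
  change T.omega (fun i => (P.toAlgebroid hS (J x)).dualMap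
      ((θ i).toLinearMap.comp ((P.groupoid hS).infAction 𝓘(ℝ, EX) J act x))) =
    T.omega (fun i => (θ i).toLinearMap.comp (P.infGenerator (P.restrictAction J act) x))
  refine congrArg T.omega (funext fun i => LinearMap.ext fun ξ => ?_)
  exact congrArg (θ i) (P.infAction_toAlgebroid hS h x ξ)

variable {P}

/-- A `G`-action with an equivariant map `J` extends to an action of the transformation groupoid. -/
theorem IsQuasiHamiltonian.isGroupoidSpace [FiniteDimensional ℝ 𝔡] {Φ : G → X → X}
    {PX : TwoTensorField 𝓘(ℝ, EX) X} {J : X → P.S}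
    (h : P.IsQuasiHamiltonian (ES := ES) Φ PX J) :
    (P.groupoid hS).IsGroupoidSpace 𝓘(ℝ, EX) J (P.extendAction Φ) where
  smooth_J := h.smooth_J
  smooth_act := (h.action.smooth.comp
    ((contMDiff_fst.comp contMDiff_fst).prodMk contMDiff_snd)).contMDiffOn
  J_act := by
    rintro ⟨g, s⟩ x hs
    change s = J x at hs
    subst hs
    exact h.equivariant g x
  mul_act g k x _ _ := h.action.mul_act g.1 k.1 x
  unit_act := h.action.one_act

theorem IsQuasiHamiltonian.isHamiltonianSpace [FiniteDimensional ℝ 𝔡] [IsManifold 𝓘(ℝ, EX) ∞ X]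
    {Φ : G → X → X} {PX : TwoTensorField 𝓘(ℝ, EX) X} {J : X → P.S}
    (h : P.IsQuasiHamiltonian (ES := ES) Φ PX J) :
    (P.groupoid hS).IsHamiltonianSpace 𝓘(ℝ, EX) P.PiGroupoid (P.omegaSection hS) J
      (P.extendAction Φ) PX where
  space := h.isGroupoidSpace hS
  bivector := h.action.bivector
  coisotropic := by
    rw [P.graph_eq_range hS]
    exact (P.isCoisotropic_graph_iff hS h.action.bivector h.action.smooth h.action.one_act
      h.action.mul_act h.smooth_J h.equivariant).2 ⟨h.action.pushesForward, h.momentum⟩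
  half_schouten := by
    rw [P.hat_omegaSection hS (h.isGroupoidSpace hS)]
    exact h.action.half_schouten

theorem isQuasiHamiltonian_restrictAction [FiniteDimensional ℝ 𝔡] [IsManifold 𝓘(ℝ, EX) ∞ X]
    {PX : TwoTensorField 𝓘(ℝ, EX) X} {J : X → P.S} {act : G × P.S → X → X}
    (h : (P.groupoid hS).IsHamiltonianSpace 𝓘(ℝ, EX) P.PiGroupoid (P.omegaSection hS) J act PX) :
    P.IsQuasiHamiltonian (ES := ES) (P.restrictAction J act) PX J := by
  have hJ : ContMDiff 𝓘(ℝ, EX) 𝓘(ℝ, ES) ∞ J := h.space.smooth_J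
  have hΦ : ContMDiff (𝓘(ℝ, EG).prod 𝓘(ℝ, EX)) 𝓘(ℝ, EX) ∞
      (fun p : G × X => P.restrictAction J act p.1 p.2) :=
    -- Smoothness on the fibre product gives smoothness on all of `G × X`, because this smooth map
    -- lands in the fibre product.
    h.space.smooth_act.comp_contMDiff (f := fun p : G × X => ((p.1, J p.2), p.2))
      ((contMDiff_fst.prodMk (hJ.comp contMDiff_snd)).prodMk contMDiff_snd) fun _ => rfl
  have h1 : ∀ x, P.restrictAction J act 1 x = x := h.space.unit_act
  have hJΦ : ∀ g x, J (P.restrictAction J act g x) = P.ι g • J x := fun g x =>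
    h.space.J_act (g, J x) x rfl
  have hmul : ∀ g k x, P.restrictAction J act (g * k) x =
      P.restrictAction J act g (P.restrictAction J act k x) := by
    intro g k x
    -- The factorisation used is `(gk, J x) = (g, k J x)(k, J x)`; equivariance then identifies `k J
    -- x` with the momentum of the moved point.
    have := h.space.mul_act (g, P.ι k • J x) (k, J x) x rfl rfl
    change act (g * k, J x) x = act (g, J (P.restrictAction J act k x)) _
    rw [hJΦ]
    exact this
  have hco := h.coisotropic
  rw [P.graph_eq_range hS] at hco
  obtain ⟨hpush, hmom⟩ := (P.isCoisotropic_graph_iff hS h.bivector hΦ h1 hmul hJ hJΦ).1 hco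
  exact
    { action :=
        { bivector := h.bivector
          smooth := hΦ
          one_act := h1
          mul_act := hmul
          pushesForward := hpush
          half_schouten := P.hat_omegaSection hS h.space ▸ h.half_schouten }
      smooth_J := hJ
      equivariant := hJΦ
      momentum := hmom }

end GroupPair

end QuasiPoisson

theorem mainTheorem4
    {𝔡 : Type*} [LieRing 𝔡] [LieAlgebra ℝ 𝔡] [FiniteDimensional ℝ 𝔡] (T : ManinQuasiTriple 𝔡)
    {ED : Type*} [NormedAddCommGroup ED] [NormedSpace ℝ ED] [FiniteDimensional ℝ ED]
    {D : Type*} [Group D] [TopologicalSpace D] [ChartedSpace ED D] [LieGroup 𝓘(ℝ, ED) ∞ D]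
    [SimplyConnectedSpace D]
    {EG : Type*} [NormedAddCommGroup EG] [NormedSpace ℝ EG] [FiniteDimensional ℝ EG]
    {G : Type*} [Group G] [TopologicalSpace G] [ChartedSpace EG G] [LieGroup 𝓘(ℝ, EG) ∞ G]
    [SimplyConnectedSpace G]
    (P : GroupPair T ED D EG G)
    {ES : Type*} [NormedAddCommGroup ES] [NormedSpace ℝ ES] [FiniteDimensional ℝ ES]
    [ChartedSpace ES P.S] [IsManifold 𝓘(ℝ, ES) ∞ P.S]
    (hS : Manifold.IsSubmersion 𝓘(ℝ, ED) 𝓘(ℝ, ES) ∞ (QuotientGroup.mk : D → P.S))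
    {EX : Type*} [NormedAddCommGroup EX] [NormedSpace ℝ EX] [FiniteDimensional ℝ EX]
    {X : Type*} [TopologicalSpace X] [T2Space X] [ChartedSpace EX X] [IsManifold 𝓘(ℝ, EX) ∞ X]
    (PX : TwoTensorField 𝓘(ℝ, EX) X) (J : X → P.S) :
    (∀ Φ : G → X → X, P.IsQuasiHamiltonian (ES := ES) Φ PX J →
      (P.groupoid hS).IsHamiltonianSpace 𝓘(ℝ, EX) P.PiGroupoid (P.omegaSection hS) J
          (P.extendAction Φ) PX ∧
        P.restrictAction J (P.extendAction Φ) = Φ) ∧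
    (∀ act : G × P.S → X → X,
      (P.groupoid hS).IsHamiltonianSpace 𝓘(ℝ, EX) P.PiGroupoid (P.omegaSection hS) J act PX →
        P.IsQuasiHamiltonian (ES := ES) (P.restrictAction J act) PX J ∧
        ∀ (g : G) (s : P.S) (x : X), J x = s →
          P.extendAction (P.restrictAction J act) (g, s) x = act (g, s) x) := by
  -- Extending and then restricting is the identity by definition. The other composite replaces `s`
  -- by `J x`, hence agrees with `act` exactly where the action is meaningful.
  refine ⟨fun Φ h => ⟨h.isHamiltonianSpace hS, rfl⟩, fun act h =>
    ⟨GroupPair.isQuasiHamiltonian_restrictAction hS h, ?_⟩⟩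
  rintro g _ x rfl
  rfl
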